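/- Let $(M,\Omega,\theta)$ be a locally conformal symplectic manifold: $M$ is a smooth (Hausdorff, finite-dimensional) manifold without boundary, $\Omega$ is a smooth nondegenerate $2$-form and $\theta$ a smooth closed $1$-form on $M$ with $d\Omega=\theta\wedge\Omega$. On the extended phase space $\mathbb R\times M$, with time coordinate $t$ and projection $\mathrm{pr}:\mathbb R\times M\to M$, put $\hat\Omega=\mathrm{pr}^*\Omega$, $\hat\theta=\mathrm{pr}^*\theta$, and $d^{\hat\theta}f=df-f\hat\theta$ for functions $f$. A vector field $X$ on $\mathbb R\times M$ is called *Hamiltonian* if $X\lrcorner dt=0$ and $X\lrcorner\hat\Omega=d^{\hat\theta}f-\frac{\partial f}{\partial t}\,dt$ for some $f\in C^\infty(\mathbb R\times M)$, and *locally Hamiltonian* if every point of $M$ has an open neighbourhood $U$ such that these equations hold on $\mathbb R\times U$ for some $f\in C^\infty(\mathbb R\times U)$. A diffeomorphism $F:W\to W'$ between open subsets of $\mathbb R\times M$ is called *canonical* if $F^*t=t$, $F^*\hat\theta=\hat\theta$ and there is $K\in C^\infty(W)$ with $F^*\hat\Omega=\hat\Omega+d^{\hat\theta}K\wedge dt$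 on $W$. It is called *locally canonical* if $F^*t=t$, $F^*\hat\theta=\hat\theta$ and every point of $W$ has an open neighbourhood in $W$ on which such a function $K$ exists. Let $\{\Psi_s\}$ be a (possibly local) one-parameter group of transformations of $\mathbb R\times M$, i.e. a smooth flow $(s,p)\mapsto\Psi_s(p)$ defined on an open set $D\subseteq\mathbb R\times(\mathbb R\times M)$ such that for every $p$ the set $\{s:(s,p)\in D\}$ is an interval containing $0$, with $\Psi_0=\mathrm{id}$ and $\Psi_r\circ\Psi_s=\Psi_{s+r}$ wherever both sides are defined. Let $D_s=\{p:(s,p)\in D\}$ be the domain of $\Psi_s$. Suppose that the infinitesimal generator $X$ of $\{\Psi_s\}$, a smooth vector field, satisfies $X\lrcorner\hat\theta=0$. Then: 1. $\Psi_s$ is a locally canonical diffeomorphism of $D_s$ onto an open set $\Psi_s(D_s)$ for every $s\in\mathbb R$ if and only if $X$ is a locally Hamiltonian vector field. 2. If $X$ is a Hamiltonian vector field, then $\Psi_s:D_s\to\Psi_s(D_s)$ is a canonical diffeomorphism for every $s\in\mathbb R$. -/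

import Mathlib

open Set
open scoped Manifold ContDiff Topology

noncomputable section

namespace LCS

section Linear

variable {E : Type*} [NormedAddCommGroup E] [NormedSpace ℝ E]

/-- The wedge product of an alternating `1`-form with an alternating `k`-form on a vector space. -/
def wedgeLin {k : ℕ} (α : E [⋀^Fin 1]→L[ℝ] ℝ) (η : E [⋀^Fin k]→L[ℝ] ℝ) :
    E [⋀^Fin (k + 1)]→L[ℝ] ℝ :=
  ContinuousAlternatingMap.alternatizeUncurryFin
    (((ContinuousAlternatingMap.ofSubsingleton ℝ E ℝ (0 : Fin 1)).symm α).smulRight η)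

end Linear

section Forms

variable {E : Type*} [NormedAddCommGroup E] [NormedSpace ℝ E]
  {H : Type*} [TopologicalSpace H] (I : ModelWithCorners ℝ E H)
  {N : Type*} [TopologicalSpace N] [ChartedSpace H N]

variable (N) in
/-- Differential `k`-forms on `N` (smoothness is the separate predicate `IsSmoothForm`). -/
abbrev DForm (k : ℕ) : Type _ :=
  (x : N) → TangentSpace I x [⋀^Fin k]→L[ℝ] ℝ

variable {I}

/-- The differential of a real function, as a `1`-form. -/
def dFun (f : N → ℝ) : DForm I N 1 := fun x =>
  ContinuousAlternatingMap.ofSubsingleton ℝ (TangentSpace I x) ℝ (0 : Fin 1)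
    (mfderiv I 𝓘(ℝ, ℝ) f x : TangentSpace I x →L[ℝ] ℝ)

/-- The wedge product `α ∧ η` of a `1`-form with a `k`-form,
`(α ∧ η)(v₀, …, v_k) = ∑ᵢ (-1)ⁱ α(vᵢ) η(v₀, …, v̂ᵢ, …, v_k)`. -/
def wedge {k : ℕ} (α : DForm I N 1) (η : DForm I N k) : DForm I N (k + 1) := fun x =>
  wedgeLin (E := E) (α x) (η x)

/-- The interior product `X ⌟ η`. -/
def interiorProd {k : ℕ} (X : (x : N) → TangentSpace I x) (η : DForm I N (k + 1)) :
    DForm I N k := fun x =>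
  ContinuousAlternatingMap.curryLeft (E := E) (η x) (X x)

/-- The Lichnerowicz–de Rham differential of a function, `d^θ f = df - f θ`. -/
def dTwist (θ : DForm I N 1) (f : N → ℝ) : DForm I N 1 := fun x =>
  dFun (I := I) f x - f x • θ x

variable {E' : Type*} [NormedAddCommGroup E'] [NormedSpace ℝ E']
  {H' : Type*} [TopologicalSpace H'] {I' : ModelWithCorners ℝ E' H'}
  {N' : Type*} [TopologicalSpace N'] [ChartedSpace H' N']

/-- The pullback `F^* η`. -/
def pullback {k : ℕ} (F : N → N') (η : DForm I' N' k) : DForm I N k := fun x =>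
  (η (F x)).compContinuousLinearMap (mfderiv I I' F x)

end Forms

section Structures

variable {E : Type*} [NormedAddCommGroup E] [NormedSpace ℝ E]
  {M : Type*} [TopologicalSpace M] [ChartedSpace E M]

/-- The expression of a form in the preferred chart at `x₀`: the pullback of `η` by the inverse
of the chart. Only its values on the chart's target are meaningful. -/
def inChart {k : ℕ} (η : DForm 𝓘(ℝ, E) M k) (x₀ : M) : E → E [⋀^Fin k]→L[ℝ] ℝ :=
  pullback (I := 𝓘(ℝ, E)) (extChartAt 𝓘(ℝ, E) x₀).symm η

/-- A form is smooth if all its chart expressions are. -/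
def IsSmoothForm {k : ℕ} (η : DForm 𝓘(ℝ, E) M k) : Prop :=
  ∀ x₀ : M, ContDiffOn ℝ ∞ (inChart η x₀) (extChartAt 𝓘(ℝ, E) x₀).target

/-- The exterior derivative: at `x`, the pullback by the chart at `x` of the exterior derivative
of the chart expression of the form. -/
def extD {k : ℕ} (η : DForm 𝓘(ℝ, E) M k) : DForm 𝓘(ℝ, E) M (k + 1) := fun x =>
  (extDeriv (inChart η x) (extChartAt 𝓘(ℝ, E) x x)).compContinuousLinearMap
    (mfderiv 𝓘(ℝ, E) 𝓘(ℝ, E) (extChartAt 𝓘(ℝ, E) x) x : TangentSpace 𝓘(ℝ, E) x →L[ℝ] E)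

/-- `(M, Ω, θ)` is a locally conformal symplectic manifold. (Nondegeneracy of `Ω` forces the
dimension of `M` to be even.) -/
structure IsLCS (Ω : DForm 𝓘(ℝ, E) M 2) (θ : DForm 𝓘(ℝ, E) M 1) : Prop where
  smooth_form : IsSmoothForm Ω
  smooth_lee : IsSmoothForm θ
  nondegenerate : ∀ (x : M) (v : TangentSpace 𝓘(ℝ, E) x),
    (∀ w : TangentSpace 𝓘(ℝ, E) x, Ω x ![v, w] = 0) → v = 0
  closed_lee : extD θ = 0
  extD_form : extD Ω = wedge θ Ω

variable (E) in
/-- The model with corners of the extended phase space `ℝ × M`. -/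
abbrev extModel : ModelWithCorners ℝ (ℝ × E) (ModelProd ℝ E) := 𝓘(ℝ, ℝ).prod 𝓘(ℝ, E)

/-- The pullback `pr^* η` to `ℝ × M` of a form on `M`. -/
def hat {k : ℕ} (η : DForm 𝓘(ℝ, E) M k) : DForm (extModel E) (ℝ × M) k :=
  pullback (Prod.snd : ℝ × M → M) η

variable (E M) in
/-- The form `dt` on `ℝ × M`. -/
def dt : DForm (extModel E) (ℝ × M) 1 := dFun (Prod.fst : ℝ × M → ℝ)

/-- The partial derivative `∂f/∂t` of a function on `ℝ × M`. -/
def partialT (f : ℝ × M → ℝ) (p : ℝ × M) : ℝ := deriv (fun τ : ℝ => f (τ, p.2)) p.1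

/-- On the set `S`, `X` is the Hamiltonian vector field of the function `f`:
`X ⌟ dt = 0` and `X ⌟ Ω̂ = d^θ̂ f - (∂f/∂t) dt`. -/
structure IsHamiltonianForOn (Ω : DForm 𝓘(ℝ, E) M 2) (θ : DForm 𝓘(ℝ, E) M 1)
    (X : (p : ℝ × M) → TangentSpace (extModel E) p) (f : ℝ × M → ℝ) (S : Set (ℝ × M)) :
    Prop where
  smooth : ContMDiffOn (extModel E) 𝓘(ℝ, ℝ) ∞ f S
  interior_dt : ∀ p ∈ S, interiorProd X (dt E M) p = 0
  interior_form : ∀ p ∈ S,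
    interiorProd X (hat Ω) p = dTwist (hat θ) f p - partialT f p • dt E M p

/-- `X` is a (globally) Hamiltonian vector field on `ℝ × M`. -/
def IsHamiltonian (Ω : DForm 𝓘(ℝ, E) M 2) (θ : DForm 𝓘(ℝ, E) M 1)
    (X : (p : ℝ × M) → TangentSpace (extModel E) p) : Prop :=
  ∃ f : ℝ × M → ℝ, IsHamiltonianForOn Ω θ X f univ

/-- `X` is a locally time-dependent Hamiltonian vector field: every point of `M` has an open
neighbourhood `U` such that `X` has a Hamiltonian function on `ℝ × U`. -/
def IsLocallyHamiltonian (Ω : DForm 𝓘(ℝ, E) M 2) (θ : DForm 𝓘(ℝ, E) M 1)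
    (X : (p : ℝ × M) → TangentSpace (extModel E) p) : Prop :=
  ∀ x : M, ∃ U : Set M, IsOpen U ∧ x ∈ U ∧
    ∃ f : ℝ × M → ℝ, IsHamiltonianForOn Ω θ X f (univ ×ˢ U)

/-- `F` restricts to a diffeomorphism from the open set `U` of `ℝ × M` onto the open set `V`
which preserves the time coordinate and the form `θ̂`. -/
structure IsTimeLeeDiffeo (θ : DForm 𝓘(ℝ, E) M 1) (F : ℝ × M → ℝ × M)
    (U V : Set (ℝ × M)) : Prop where
  isOpen_source : IsOpen U
  isOpen_target : IsOpen V
  image_eq : F '' U = V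
  smooth : ContMDiffOn (extModel E) (extModel E) ∞ F U
  smooth_inverse : ∃ G : ℝ × M → ℝ × M,
    ContMDiffOn (extModel E) (extModel E) ∞ G V ∧ LeftInvOn G F U
  time : ∀ p ∈ U, (F p).1 = p.1
  lee : ∀ p ∈ U, pullback F (hat θ) p = hat θ p

/-- `K` is smooth on `W` and `F^* Ω̂ = Ω̂ + d^θ̂ K ∧ dt` there. -/
structure IsGeneratingOn (Ω : DForm 𝓘(ℝ, E) M 2) (θ : DForm 𝓘(ℝ, E) M 1)
    (F : ℝ × M → ℝ × M) (K : ℝ × M → ℝ) (W : Set (ℝ × M)) : Prop where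
  smooth : ContMDiffOn (extModel E) 𝓘(ℝ, ℝ) ∞ K W
  pullback_form : ∀ p ∈ W,
    pullback F (hat Ω) p = hat Ω p + wedge (dTwist (hat θ) K) (dt E M) p

/-- `F` is a canonical transformation from `U` onto `V`, with the function `K_F` defined on all
of `U`. For `U = V = univ` these are the canonical transformations of the extended phase space. -/
def IsCanonical (Ω : DForm 𝓘(ℝ, E) M 2) (θ : DForm 𝓘(ℝ, E) M 1)
    (F : ℝ × M → ℝ × M) (U V : Set (ℝ × M)) : Prop :=
  IsTimeLeeDiffeo θ F U V ∧ ∃ K : ℝ × M → ℝ, IsGeneratingOn Ω θ F K U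

/-- `F` is a canonical transformation from `U` onto `V` in the local sense: the function `K_F`
is only required to exist near each point of `U`. -/
def IsLocallyCanonical (Ω : DForm 𝓘(ℝ, E) M 2) (θ : DForm 𝓘(ℝ, E) M 1)
    (F : ℝ × M → ℝ × M) (U V : Set (ℝ × M)) : Prop :=
  IsTimeLeeDiffeo θ F U V ∧
    ∀ p ∈ U, ∃ W : Set (ℝ × M), IsOpen W ∧ p ∈ W ∧ W ⊆ U ∧
      ∃ K : ℝ × M → ℝ, IsGeneratingOn Ω θ F K W

end Structures

section Flows

variable {E : Type*} [NormedAddCommGroup E] [NormedSpace ℝ E]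
  {H : Type*} [TopologicalSpace H] (I : ModelWithCorners ℝ E H)
  {N : Type*} [TopologicalSpace N] [ChartedSpace H N]

/-- `Ψ` is a (possibly local) one-parameter group of transformations of `N`, with flow domain
`D ⊆ ℝ × N`; it is a global one-parameter group when `D = univ`. -/
structure IsLocalFlow (Ψ : ℝ → N → N) (D : Set (ℝ × N)) : Prop where
  isOpen : IsOpen D
  zero_mem : ∀ p : N, ((0 : ℝ), p) ∈ D
  interval : ∀ p : N, OrdConnected {s : ℝ | (s, p) ∈ D}
  smooth : ContMDiffOn (𝓘(ℝ, ℝ).prod I) I ∞ (fun z : ℝ × N => Ψ z.1 z.2) D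
  map_zero : ∀ p : N, Ψ 0 p = p
  map_add : ∀ (s r : ℝ) (p : N), (s, p) ∈ D → (r, Ψ s p) ∈ D → (s + r, p) ∈ D →
    Ψ r (Ψ s p) = Ψ (s + r) p

/-- `X` is the infinitesimal generator of `Ψ`: `X(p)` is the velocity at `s = 0` of
`s ↦ Ψ_s(p)`. -/
def IsGenerator (Ψ : ℝ → N → N) (X : (p : N) → TangentSpace I p) : Prop :=
  ∀ p : N, HasMFDerivAt 𝓘(ℝ, ℝ) I (fun s : ℝ => Ψ s p) 0
    ((1 : ℝ →L[ℝ] ℝ).smulRight (X (Ψ 0 p)))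

/-- The domain of the transformation `Ψ_s` of a local flow with flow domain `D`. -/
def timeDomain (D : Set (ℝ × N)) (s : ℝ) : Set N := {p : N | (s, p) ∈ D}

end Flows

end LCS

end

/-! Write `β = X ⌟ Ω̂`. Cartan's formula together with `dΩ = θ ∧ Ω`, `dθ = 0` and `θ̂(X) = 0` gives
`L_X θ̂ = 0` and `L_X Ω̂ = dβ - θ̂ ∧ β`, the Lichnerowicz differential `d^θ̂ β`
(`hasDerivAt_pullback_lee`, `hasDerivAt_pullback_form`). Both parts of the theorem are read off from
this.

If `β = d^θ̂ f - f_t dt`, then `d^θ̂ d^θ̂ f = 0` leaves `L_X Ω̂ = -d^θ̂ f_t ∧ dt`. The flow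
preserves `t` and `θ̂`, so `d/dσ Ψ_σ^* Ω̂ = -d^θ̂ (f_t ∘ Ψ_σ) ∧ dt`, and integration gives the
generating function `K = -∫ f_t ∘ Ψ_σ dσ` (`pullback_flow_form`). A global `f` gives `K` on all of
`D_s`. When `f` exists only locally, an orbit is cut into short pieces and the increments of `K` are
added (`isGeneratingOn_of_uIcc`).

Conversely, `d^θ̂ K ∧ dt` vanishes on pairs of vectors tangent to the slices `t = const`, so a
locally canonical flow preserves `Ω̂` on such pairs. Differentiating at `s = 0` shows that `β` is
`d^θ`-closed on each slice. A Poincaré lemma for `d^θ` with smooth parameter `t`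
(`exists_twisted_primitive_on_ball`) gives `f` with `d^θ f = β` on the slices; the `∂/∂t` component
of the Hamiltonian equation then holds automatically.

The flow domain need not be maximal: `Ψ_{-s}` may be undefined at `Ψ_s(p)`. Injectivity and local
invertibility of `Ψ_s` are therefore propagated along orbits in small steps (`uIcc_induction`). -/

open Set
open scoped Manifold ContDiff Topology

noncomputable section

namespace LCS

/-! ### Tubes around compact segments -/

section Tube

variable {Y : Type*} [TopologicalSpace Y] {a b : ℝ} {O : Set (ℝ × Y)}

/-- The points `y` such that the segment `[a, b] × {y}` is contained in `O`. -/
def segmentTube (a b : ℝ) (O : Set (ℝ × Y)) : Set Y := {y | ∀ σ ∈ uIcc a b, (σ, y) ∈ O}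

theorem isOpen_segmentTube (hO : IsOpen O) : IsOpen (segmentTube a b O) := by
  refine isOpen_iff_forall_mem_open.2 fun y hy => ?_
  obtain ⟨u, v, -, hv, hu, hyv, huv⟩ := generalized_tube_lemma (s := uIcc a b) isCompact_uIcc
    (isCompact_singleton (x := y)) hO (by rintro ⟨σ, z⟩ ⟨hσ, rfl⟩; exact hy σ hσ)
  exact ⟨v, fun z hz σ hσ => huv ⟨hu hσ, hz⟩, hv, hyv rfl⟩

theorem continuousOn_slice {Z : Type*} [TopologicalSpace Z] {F : ℝ × Y → Z}
    (hF : ContinuousOn F O) {y : Y} (hy : y ∈ segmentTube a b O) :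
    ContinuousOn (fun σ => F (σ, y)) (uIcc a b) :=
  hF.comp (by fun_prop) hy

end Tube

/-! ### Smoothness of integrals depending on a parameter -/

section ParametricIntegral

variable {V : Type*} [NormedAddCommGroup V] [NormedSpace ℝ V]
  {G : Type*} [NormedAddCommGroup G] [NormedSpace ℝ G]

theorem hasFDerivAt_intervalIntegral {F : ℝ × V → G} {a b : ℝ} {O : Set (ℝ × V)}
    (hO : IsOpen O) (hF : ContDiffOn ℝ 1 F O) {y : V} (hy : y ∈ segmentTube a b O) :
    HasFDerivAt (fun z => ∫ σ in a..b, F (σ, z))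
      (∫ σ in a..b, (fderiv ℝ F (σ, y)).comp (ContinuousLinearMap.inr ℝ ℝ V)) y := by
  have hF' : ContinuousOn (fun z => (fderiv ℝ F z).comp (ContinuousLinearMap.inr ℝ ℝ V)) O :=
    (hF.continuousOn_fderiv_of_isOpen hO le_rfl).clm_comp continuousOn_const
  obtain ⟨C, hC⟩ := (isCompact_uIcc (a := a) (b := b)).bddAbove_image
    (continuousOn_slice hF' hy).norm
  -- Compactness of the segment bounds the derivative by `C` over `y`; the tube where it stays below
  -- `C + 1` is a neighbourhood of `y` with a uniform dominating constant.
  set W := segmentTube a b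
    (O ∩ (fun z => ‖(fderiv ℝ F z).comp (ContinuousLinearMap.inr ℝ ℝ V)‖) ⁻¹' Iio (C + 1))
  have hW : IsOpen W :=
    isOpen_segmentTube (hF'.norm.isOpen_inter_preimage hO (isOpen_Iio (a := C + 1)))
  have hyW : y ∈ W := fun σ hσ => ⟨hy σ hσ, by
    have := hC (mem_image_of_mem _ hσ)
    simp only [mem_preimage, mem_Iio] at this ⊢
    linarith⟩
  have hWt : W ⊆ segmentTube a b O := fun z hz σ hσ => (hz σ hσ).1
  refine intervalIntegral.hasFDerivAt_integral_of_dominated_of_fderiv_le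
    (F := fun z σ => F (σ, z))
    (F' := fun z σ => (fderiv ℝ F (σ, z)).comp (ContinuousLinearMap.inr ℝ ℝ V))
    (bound := fun _ => C + 1) (hW.mem_nhds hyW) ?_ ?_ ?_ ?_ ?_ ?_
  · filter_upwards [hW.mem_nhds hyW] with z hz
    exact ((continuousOn_slice hF.continuousOn (hWt hz)).mono
      uIoc_subset_uIcc).aestronglyMeasurable measurableSet_uIoc
  · exact (continuousOn_slice hF.continuousOn hy).intervalIntegrable
  · exact ((continuousOn_slice hF' hy).mono uIoc_subset_uIcc).aestronglyMeasurable
      measurableSet_uIoc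
  · exact Filter.Eventually.of_forall fun σ hσ z hz =>
      le_of_lt (hz σ (uIoc_subset_uIcc hσ)).2
  · exact intervalIntegrable_const
  · refine Filter.Eventually.of_forall fun σ hσ z hz => ?_
    have h1 : HasFDerivAt F (fderiv ℝ F (σ, z)) (σ, z) :=
      ((hF.contDiffAt (hO.mem_nhds (hWt hz σ (uIoc_subset_uIcc hσ)))).differentiableAt
        one_ne_zero).hasFDerivAt
    exact h1.comp z (hasFDerivAt_prodMk_right σ z)

theorem fderiv_intervalIntegral_apply {F : ℝ × V → G} {a b : ℝ}
    {O : Set (ℝ × V)} (hO : IsOpen O) (hF : ContDiffOn ℝ 1 F O) {y : V}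
    (hy : y ∈ segmentTube a b O) (v : V) :
    fderiv ℝ (fun z => ∫ σ in a..b, F (σ, z)) y v = ∫ σ in a..b, fderiv ℝ F (σ, y) (0, v) := by
  rw [(hasFDerivAt_intervalIntegral hO hF hy).fderiv]
  have hF' : ContinuousOn (fun z => (fderiv ℝ F z).comp (ContinuousLinearMap.inr ℝ ℝ V)) O :=
    (hF.continuousOn_fderiv_of_isOpen hO le_rfl).clm_comp continuousOn_const
  rw [ContinuousLinearMap.intervalIntegral_apply (continuousOn_slice hF' hy).intervalIntegrable]
  rfl

/-- Induction on the order of differentiability: the derivative in a fixed direction is again an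
integral of the same kind, and in finite dimension it suffices to test the derivative on fixed
directions. -/
theorem contDiffOn_intervalIntegral [FiniteDimensional ℝ V] {F : ℝ × V → G} {a b : ℝ}
    {O : Set (ℝ × V)} (hO : IsOpen O) (hF : ContDiffOn ℝ ∞ F O) :
    ContDiffOn ℝ ∞ (fun z => ∫ σ in a..b, F (σ, z)) (segmentTube a b O) := by
  have hT := isOpen_segmentTube (a := a) (b := b) hO
  refine contDiffOn_infty.2 fun n => ?_
  induction n generalizing F with
  | zero =>
    exact contDiffOn_zero.2 fun y hy => (hasFDerivAt_intervalIntegral hO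
      (hF.of_le (by exact_mod_cast le_top)) hy).continuousAt.continuousWithinAt
  | succ n ih =>
    have h1 : ContDiffOn ℝ 1 F O := hF.of_le (by exact_mod_cast le_top)
    refine (contDiffOn_succ_iff_fderiv_of_isOpen hT).2 ⟨fun y hy =>
      (hasFDerivAt_intervalIntegral hO h1 hy).differentiableAt.differentiableWithinAt,
      fun h => absurd h (WithTop.natCast_ne_top n), contDiffOn_clm_apply.2 fun v => ?_⟩
    refine (ih (F := fun z => fderiv ℝ F z (0, v)) ?_).congr fun y hy =>
      fderiv_intervalIntegral_apply hO h1 hy v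
    exact ((contDiffOn_infty_iff_fderiv_of_isOpen hO).1 hF).2.clm_apply contDiffOn_const

end ParametricIntegral

/-! ### The Poincaré lemma with parameters -/

section Poincare

variable {T : Type*} [NormedAddCommGroup T] [NormedSpace ℝ T] [FiniteDimensional ℝ T]
  {E : Type*} [NormedAddCommGroup E] [NormedSpace ℝ E] [FiniteDimensional ℝ E]

/-- The Poincaré lemma for `1`-forms on a ball depending smoothly on a parameter. -/
theorem exists_primitive_on_ball {c : E} {R : ℝ} {β : T × E → E →L[ℝ] ℝ}
    (hβ : ContDiffOn ℝ ∞ β (univ ×ˢ Metric.ball c R))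
    (hsymm : ∀ z ∈ (univ : Set T) ×ˢ Metric.ball c R, ∀ v w : E,
      fderiv ℝ β z (0, v) w = fderiv ℝ β z (0, w) v) :
    ∃ h : T × E → ℝ, ContDiffOn ℝ ∞ h (univ ×ˢ Metric.ball c R) ∧
      ∀ z ∈ (univ : Set T) ×ˢ Metric.ball c R, ∀ v : E, fderiv ℝ h z (0, v) = β z v := by
  set S : Set (T × E) := univ ×ˢ Metric.ball c R with hS
  have hSo : IsOpen S := isOpen_univ.prod Metric.isOpen_ball
  -- Contraction of the ball to its centre with the parameter fixed. The primitive is `∫₀¹ β(t, c +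
  -- σ(y - c))(y - c) dσ`.
  let m : ℝ × (T × E) → T × E := fun x => (x.2.1, c + x.1 • (x.2.2 - c))
  have hm : ContDiff ℝ ∞ m := by fun_prop
  let O : Set (ℝ × (T × E)) := m ⁻¹' S
  have hO : IsOpen O := hSo.preimage hm.continuous
  let F : ℝ × (T × E) → ℝ := fun x => β (m x) (x.2.2 - c)
  have hF : ContDiffOn ℝ ∞ F O :=
    (hβ.comp hm.contDiffOn (fun x hx => hx)).clm_apply (by fun_prop)
  have hF1 : ContDiffOn ℝ 1 F O := hF.of_le (by exact_mod_cast le_top)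
  have hST : S ⊆ segmentTube 0 1 O := by
    rintro ⟨t, y⟩ ⟨-, hy⟩ σ hσ
    rw [uIcc_of_le zero_le_one] at hσ
    refine ⟨mem_univ _, ?_⟩
    have := (convex_ball c R).add_smul_sub_mem
      (Metric.mem_ball_self (Metric.pos_of_mem_ball hy)) hy hσ
    simpa [m] using this
  refine ⟨fun z => ∫ σ in (0 : ℝ)..1, F (σ, z), (contDiffOn_intervalIntegral hO hF).mono hST,
    fun z hz v => ?_⟩
  rw [fderiv_intervalIntegral_apply hO hF1 (hST hz)]
  have hβd : ∀ σ ∈ uIcc (0 : ℝ) 1, HasFDerivAt β (fderiv ℝ β (m (σ, z))) (m (σ, z)) :=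
    fun σ hσ => ((hβ.contDiffAt (hSo.mem_nhds (hST hz σ hσ))).differentiableAt
      (by simp)).hasFDerivAt
  -- Closedness turns the `v`-derivative of the integrand into the total derivative `d/dσ (σ β(m(σ,
  -- z)) v)`, whose integral over `[0, 1]` is `β z v`.
  have key : ∀ σ ∈ uIcc (0 : ℝ) 1, HasDerivAt (fun σ : ℝ => σ * β (m (σ, z)) v)
      (fderiv ℝ F (σ, z) (0, ((0 : T), v))) σ := by
    intro σ hσ
    have hm1 : HasDerivAt (fun σ : ℝ => m (σ, z)) ((0 : T), z.2 - c) σ := by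
      have h2 : HasDerivAt (fun σ : ℝ => c + σ • (z.2 - c)) (z.2 - c) σ := by
        simpa using ((hasDerivAt_id σ).smul_const (z.2 - c)).const_add c
      exact (hasDerivAt_const σ z.1).prodMk h2
    have hm2 : HasDerivAt (fun τ : ℝ => m (σ, z + τ • ((0 : T), v))) ((0 : T), σ • v) 0 := by
      have h2 : HasDerivAt (fun τ : ℝ => c + σ • (z.2 + τ • v - c)) (σ • v) 0 := by
        have := (((((hasDerivAt_id (0 : ℝ)).smul_const v).const_add z.2).sub_const
          c).const_smul σ).const_add c
        simpa using this
      have h1 : HasDerivAt (fun τ : ℝ => z.1 + τ • (0 : T)) 0 0 := by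
        simpa using hasDerivAt_const (0 : ℝ) z.1
      exact h1.prodMk h2
    have hL1 : HasDerivAt (fun σ : ℝ => β (m (σ, z)))
        (fderiv ℝ β (m (σ, z)) ((0 : T), z.2 - c)) σ :=
      (hβd σ hσ).comp_hasDerivAt_of_eq σ hm1 rfl
    have hL := (hasDerivAt_id' σ).mul (hL1.clm_apply (hasDerivAt_const σ v))
    have hFd : HasFDerivAt F (fderiv ℝ F (σ, z)) (σ, z) :=
      ((hF1.contDiffAt (hO.mem_nhds (hST hz σ hσ))).differentiableAt one_ne_zero).hasFDerivAt
    have hl : HasDerivAt (fun τ : ℝ => (σ, z + τ • ((0 : T), v))) (0, ((0 : T), v)) 0 := by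
      refine (hasDerivAt_const _ _).prodMk ?_
      simpa using ((hasDerivAt_id (0 : ℝ)).smul_const ((0 : T), v)).const_add z
    have h0 : z + (0 : ℝ) • ((0 : T), v) = z := by rw [zero_smul, add_zero]
    have hR1 : HasDerivAt (fun τ : ℝ => F (σ, z + τ • ((0 : T), v)))
        (fderiv ℝ F (σ, z) (0, ((0 : T), v))) 0 :=
      hFd.comp_hasDerivAt_of_eq (0 : ℝ) hl (by rw [h0])
    have hR2 : HasDerivAt (fun τ : ℝ => F (σ, z + τ • ((0 : T), v)))
        (fderiv ℝ β (m (σ, z)) (0, σ • v) (z.2 - c) + β (m (σ, z)) v) 0 := by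
      have h3 : HasDerivAt (fun τ : ℝ => z.2 + τ • v - c) v 0 := by
        simpa using (((hasDerivAt_id (0 : ℝ)).smul_const v).const_add z.2).sub_const c
      have h4 : HasDerivAt (fun τ : ℝ => β (m (σ, z + τ • ((0 : T), v))))
          (fderiv ℝ β (m (σ, z)) (0, σ • v)) 0 :=
        (hβd σ hσ).comp_hasDerivAt_of_eq (0 : ℝ) hm2 (by rw [h0])
      refine (h4.clm_apply h3).congr_deriv ?_
      rw [h0, zero_smul, add_zero]
    have hR : fderiv ℝ F (σ, z) (0, ((0 : T), v)) =
        fderiv ℝ β (m (σ, z)) (0, σ • v) (z.2 - c) + β (m (σ, z)) v := by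
      exact hR1.unique hR2
    rw [hR]
    refine hL.congr_deriv ?_
    rw [show ((0 : T), σ • v) = σ • ((0 : T), v) by simp, map_smul,
      smul_apply, hsymm _ (hST hz σ hσ)]
    simp [add_comm]
  have hcont : ContinuousOn (fun x => fderiv ℝ F x (0, ((0 : T), v))) O :=
    (hF1.continuousOn_fderiv_of_isOpen hO le_rfl).clm_apply continuousOn_const
  rw [intervalIntegral.integral_eq_sub_of_hasDerivAt key
    (continuousOn_slice hcont (hST hz)).intervalIntegrable]
  simp [m]

end Poincare

/-! ### Cartan's formula for a smooth family of maps -/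

section HomotopyFormula

variable {V : Type*} [NormedAddCommGroup V] [NormedSpace ℝ V]
  {E : Type*} [NormedAddCommGroup E] [NormedSpace ℝ E]

theorem two_le_infty : (2 : WithTop ℕ∞) ≤ ∞ := WithTop.coe_le_coe.2 (le_top : (2 : ℕ∞) ≤ ⊤)

theorem differentiableAt_pullback {k : ℕ} {φ : V → E} {x : V} (hφ : ContDiffAt ℝ ∞ φ x)
    {κ : E → E [⋀^Fin k]→L[ℝ] ℝ} (hκ : DifferentiableAt ℝ κ (φ x)) :
    DifferentiableAt ℝ (fun y => (κ (φ y)).compContinuousLinearMap (fderiv ℝ φ y)) x := by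
  have h1 : DifferentiableAt ℝ φ x := hφ.differentiableAt (by simp)
  have h2 : DifferentiableAt ℝ (fderiv ℝ φ) x :=
    (hφ.fderiv_right (m := 1) (by rw [one_add_one_eq_two]; exact two_le_infty)).differentiableAt one_ne_zero
  exact DifferentiableAt.continuousAlternatingMapCompContinuousLinearMap
    (DifferentiableAt.comp (g := κ) x hκ h1) h2

theorem fderiv_apply_prodMk_zero {g : ℝ × V → E} {r : ℝ} {z : V}
    (hg : DifferentiableAt ℝ g (r, z)) (v : V) :
    fderiv ℝ g (r, z) (0, v) = fderiv ℝ (fun z => g (r, z)) z v := by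
  have := (hg.hasFDerivAt.comp z (hasFDerivAt_prodMk_right r z)).fderiv
  have h : fderiv ℝ (fun z => g (r, z)) z = _ := this
  rw [h]
  rfl

theorem hasDerivAt_slice {g : ℝ × V → E} {r : ℝ} {z : V}
    (hg : DifferentiableAt ℝ g (r, z)) :
    HasDerivAt (fun r => g (r, z)) (fderiv ℝ g (r, z) (1, 0)) r :=
  hg.hasFDerivAt.comp_hasDerivAt_of_eq r ((hasDerivAt_id' r).prodMk (hasDerivAt_const r z)) rfl

/-- The homotopy formula for the pullback of a `1`-form by a smooth family of maps. -/
theorem hasDerivAt_pullback_one {φ : ℝ × V → E} {r : ℝ} {z : V} (hφ : ContDiffAt ℝ ∞ φ (r, z))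
    {κ : E → E [⋀^Fin 1]→L[ℝ] ℝ} (hκ : DifferentiableAt ℝ κ (φ (r, z))) (v : V) :
    HasDerivAt (fun r => κ (φ (r, z)) ![fderiv ℝ φ (r, z) (0, v)])
      (extDeriv κ (φ (r, z)) ![fderiv ℝ φ (r, z) (1, 0), fderiv ℝ φ (r, z) (0, v)] +
        fderiv ℝ (fun z => κ (φ (r, z)) ![fderiv ℝ φ (r, z) (1, 0)]) z v) r := by
  have hη := differentiableAt_pullback hφ hκ
  -- Cartan's formula is `d(φ^* κ) = φ^* dκ` on `ℝ × V`, evaluated on the constant fields `∂_r` and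
  -- `(0, v)`, whose bracket is zero.
  have hd := extDeriv_pullback (r := ∞) hκ hφ (by simpa using two_le_infty)
  have h := congrArg (fun α => α ![((1 : ℝ), (0 : V)), (0, v)]) hd
  have hg : ∀ u : Fin 1 → ℝ × V, DifferentiableAt ℝ
      (fun y => (κ (φ y)).compContinuousLinearMap (fderiv ℝ φ y) u) (r, z) := fun u =>
    hη.continuousAlternatingMap_apply_const u
  have h1 := hasDerivAt_slice (hg ![(0, v)])
  have h2 := fderiv_apply_prodMk_zero (hg ![((1 : ℝ), (0 : V))]) v
  have e1 : ∀ (L : ℝ × V →L[ℝ] E) a, L ∘ ![a] = ![L a] := fun L a => by ext i; simp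
  have e2 : ∀ (L : ℝ × V →L[ℝ] E) a b, L ∘ ![a, b] = ![L a, L b] := fun L a b => by
    ext i; fin_cases i <;> rfl
  simp only [ContinuousAlternatingMap.compContinuousLinearMap_apply, e1, e2] at h h1 h2
  refine h1.congr_deriv ?_
  rw [extDeriv_apply hη] at h
  have r0 : ∀ a b : ℝ × V, (0 : Fin 2).removeNth ![a, b] = ![b] := fun a b => by ext i <;> simp
  have r1 : ∀ a b : ℝ × V, (1 : Fin 2).removeNth ![a, b] = ![a] := fun a b => by
    ext i <;> fin_cases i <;> rfl
  simp [Fin.sum_univ_succ, -Fin.removeNth_zero, r0, r1, e1] at h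
  rw [← h2]
  linarith

/-- The homotopy formula for the pullback of a `2`-form by a smooth family of maps. -/
theorem hasDerivAt_pullback_two {φ : ℝ × V → E} {r : ℝ} {z : V} (hφ : ContDiffAt ℝ ∞ φ (r, z))
    {κ : E → E [⋀^Fin 2]→L[ℝ] ℝ} (hκ : DifferentiableAt ℝ κ (φ (r, z))) (v w : V) :
    HasDerivAt (fun r => κ (φ (r, z)) ![fderiv ℝ φ (r, z) (0, v), fderiv ℝ φ (r, z) (0, w)])
      (extDeriv κ (φ (r, z)) ![fderiv ℝ φ (r, z) (1, 0), fderiv ℝ φ (r, z) (0, v),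
          fderiv ℝ φ (r, z) (0, w)] +
        fderiv ℝ (fun z => κ (φ (r, z)) ![fderiv ℝ φ (r, z) (1, 0), fderiv ℝ φ (r, z) (0, w)])
          z v -
        fderiv ℝ (fun z => κ (φ (r, z)) ![fderiv ℝ φ (r, z) (1, 0), fderiv ℝ φ (r, z) (0, v)])
          z w) r := by
  have hη := differentiableAt_pullback hφ hκ
  have hd := extDeriv_pullback (r := ∞) hκ hφ (by simpa using two_le_infty)
  have h := congrArg (fun α => α ![((1 : ℝ), (0 : V)), (0, v), (0, w)]) hd
  have hg : ∀ u : Fin 2 → ℝ × V, DifferentiableAt ℝ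
      (fun y => (κ (φ y)).compContinuousLinearMap (fderiv ℝ φ y) u) (r, z) := fun u =>
    hη.continuousAlternatingMap_apply_const u
  have h1 := hasDerivAt_slice (hg ![(0, v), (0, w)])
  have h2 := fderiv_apply_prodMk_zero (hg ![((1 : ℝ), (0 : V)), (0, w)]) v
  have h3 := fderiv_apply_prodMk_zero (hg ![((1 : ℝ), (0 : V)), (0, v)]) w
  have e2 : ∀ (L : ℝ × V →L[ℝ] E) a b, L ∘ ![a, b] = ![L a, L b] := fun L a b => by
    ext i; fin_cases i <;> rfl
  have e3 : ∀ (L : ℝ × V →L[ℝ] E) a b c, L ∘ ![a, b, c] = ![L a, L b, L c] := fun L a b c => by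
    ext i; fin_cases i <;> rfl
  simp only [ContinuousAlternatingMap.compContinuousLinearMap_apply, e3, e2] at h h1 h2 h3
  refine h1.congr_deriv ?_
  rw [extDeriv_apply hη] at h
  have r0 : ∀ a b c : ℝ × V, (0 : Fin 3).removeNth ![a, b, c] = ![b, c] := fun a b c => by
    ext i <;> fin_cases i <;> rfl
  have r1 : ∀ a b c : ℝ × V, (1 : Fin 3).removeNth ![a, b, c] = ![a, c] := fun a b c => by
    ext i <;> fin_cases i <;> rfl
  have r2 : ∀ a b c : ℝ × V, (2 : Fin 3).removeNth ![a, b, c] = ![a, b] := fun a b c => by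
    ext i <;> fin_cases i <;> rfl
  replace h := (Fin.sum_univ_three _).symm.trans h
  simp only [r0, r1, r2, ContinuousAlternatingMap.compContinuousLinearMap_apply,
    e2] at h
  simp [-Fin.removeNth_zero] at h
  rw [← h2, ← h3]
  linarith

end HomotopyFormula

/-! ### Local flows: injectivity and smooth inverses -/

section Flow

variable {E : Type*} [NormedAddCommGroup E] [NormedSpace ℝ E]
  {H : Type*} [TopologicalSpace H] {I : ModelWithCorners ℝ E H}
  {N : Type*} [TopologicalSpace N] [ChartedSpace H N] {Ψ : ℝ → N → N} {D : Set (ℝ × N)}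

/-- Connectedness of the segment: the set of times where `Q` holds is relatively open and closed. -/
theorem uIcc_induction {a b : ℝ} {Q : ℝ → Prop}
    (h : ∀ σ ∈ uIcc a b, ∀ᶠ τ in 𝓝[uIcc a b] σ, Q σ ↔ Q τ) (ha : Q a) : Q b :=
  (isPreconnected_uIcc (a := a) (b := b)).induction₂' (fun x y => Q x → Q y)
    (fun σ hσ => (h σ hσ).mono fun _ hτ => ⟨hτ.1, hτ.2⟩)
    (fun _ _ _ _ _ _ h1 h2 => h2 ∘ h1) left_mem_uIcc right_mem_uIcc ha

namespace IsLocalFlow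

theorem contMDiffAt (h : IsLocalFlow I Ψ D) {s : ℝ} {p : N} (hs : (s, p) ∈ D) :
    ContMDiffAt (𝓘(ℝ, ℝ).prod I) I ∞ (fun z : ℝ × N => Ψ z.1 z.2) (s, p) :=
  h.smooth.contMDiffAt (h.isOpen.mem_nhds hs)

theorem contMDiffAt_time (h : IsLocalFlow I Ψ D) {s : ℝ} {p : N} (hs : (s, p) ∈ D) :
    ContMDiffAt I I ∞ (Ψ s) p :=
  (h.contMDiffAt hs).comp (f := fun q : N => (s, q)) p (contMDiffAt_const.prodMk contMDiffAt_id)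

theorem continuousAt (h : IsLocalFlow I Ψ D) {s : ℝ} {p : N} (hs : (s, p) ∈ D) :
    ContinuousAt (fun z : ℝ × N => Ψ z.1 z.2) (s, p) :=
  (h.contMDiffAt hs).continuousAt

theorem continuousAt_time (h : IsLocalFlow I Ψ D) {s : ℝ} {p : N} (hs : (s, p) ∈ D) :
    ContinuousAt (Ψ s) p :=
  (h.contMDiffAt_time hs).continuousAt

theorem continuousAt_orbit (h : IsLocalFlow I Ψ D) {s : ℝ} {p : N} (hs : (s, p) ∈ D) :
    ContinuousAt (fun σ => Ψ σ p) s :=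
  (h.continuousAt hs).comp (f := fun σ : ℝ => (σ, p)) (by fun_prop)

theorem mem_of_mem_uIcc (h : IsLocalFlow I Ψ D) {s : ℝ} {p : N} (hs : (s, p) ∈ D) {σ : ℝ}
    (hσ : σ ∈ uIcc 0 s) : (σ, p) ∈ D :=
  (h.interval p).uIcc_subset (h.zero_mem p) hs hσ

theorem eventually_mem_orbit (h : IsLocalFlow I Ψ D) {s : ℝ} {p : N} (hs : (s, p) ∈ D) :
    ∀ᶠ σ in 𝓝 s, (σ, p) ∈ D :=
  (Continuous.continuousAt (by fun_prop : Continuous fun σ : ℝ => (σ, p))).eventually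
    (h.isOpen.mem_nhds hs)

theorem eventually_mem_time (h : IsLocalFlow I Ψ D) {s : ℝ} {p : N} (hs : (s, p) ∈ D) :
    ∀ᶠ q in 𝓝 p, (s, q) ∈ D :=
  (Continuous.continuousAt (by fun_prop : Continuous fun q : N => (s, q))).eventually
    (h.isOpen.mem_nhds hs)

theorem eventually_mem_sub (h : IsLocalFlow I Ψ D) {s : ℝ} {p : N} (hs : (s, p) ∈ D) :
    ∀ᶠ σ in 𝓝 s, (s - σ, Ψ σ p) ∈ D := by
  have h1 : ContinuousAt (fun σ => (s - σ, Ψ σ p)) s :=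
    (by fun_prop : Continuous fun σ : ℝ => s - σ).continuousAt.prodMk (h.continuousAt_orbit hs)
  refine h1.eventually (h.isOpen.mem_nhds ?_)
  simpa using h.zero_mem _

theorem eventually_mem_sub' (h : IsLocalFlow I Ψ D) (s : ℝ) (p : N) :
    ∀ᶠ σ in 𝓝 s, (σ - s, Ψ s p) ∈ D := by
  have h1 : ContinuousAt (fun σ => (σ - s, Ψ s p)) s := by fun_prop
  refine h1.eventually (h.isOpen.mem_nhds ?_)
  simpa using h.zero_mem _

theorem map_sub (h : IsLocalFlow I Ψ D) {s σ : ℝ} {p : N} (hs : (s, p) ∈ D) (hσ : (σ, p) ∈ D)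
    (hr : (σ - s, Ψ s p) ∈ D) : Ψ σ p = Ψ (σ - s) (Ψ s p) := by
  have := h.map_add s (σ - s) p hs hr (by simpa using hσ)
  rw [this, add_sub_cancel]

theorem eventually_map_sub (h : IsLocalFlow I Ψ D) {s σ : ℝ} {p : N} (hs : (s, p) ∈ D)
    (hσ : (σ, p) ∈ D) (hr : (σ - s, Ψ s p) ∈ D) : ∀ᶠ q in 𝓝 p, Ψ σ q = Ψ (σ - s) (Ψ s q) := by
  filter_upwards [h.eventually_mem_time hs, h.eventually_mem_time hσ,
    (h.continuousAt_time hs).eventually (h.eventually_mem_time hr)] with q h1 h2 h3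
  exact h.map_sub h1 h2 h3

/-- Two orbits that meet at one time of their common segment meet at all nearby times, by flowing a
small amount from the meeting point. Going back to time `0` identifies the initial points. -/
theorem injOn (h : IsLocalFlow I Ψ D) (s : ℝ) : InjOn (Ψ s) (timeDomain D s) := by
  intro p hp q hq hpq
  have := uIcc_induction (a := s) (b := 0) (Q := fun σ => Ψ σ p = Ψ σ q) (fun σ hσ => ?_) hpq
  · simpa [h.map_zero] using this
  rw [uIcc_comm] at hσ ⊢
  have hσp := h.mem_of_mem_uIcc hp hσ
  have hσq := h.mem_of_mem_uIcc hq hσ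
  filter_upwards [nhdsWithin_le_nhds (h.eventually_mem_sub hσp),
    nhdsWithin_le_nhds (h.eventually_mem_sub' σ p),
    nhdsWithin_le_nhds (h.eventually_mem_orbit hσp),
    nhdsWithin_le_nhds (h.eventually_mem_orbit hσq)] with τ h1 h2 h3 h4
  refine ⟨fun he => ?_, fun he => ?_⟩
  · rw [h.map_sub hσp h3 h2, h.map_sub hσq h4 (he ▸ h2), he]
  · rw [h.map_sub h3 hσp h1, h.map_sub h4 hσq (he ▸ h1), he]

/-- `F` has a smooth local right inverse near `F p`, sending `F p` to `p`. -/
def HasLocalInverse (I : ModelWithCorners ℝ E H) (F : N → N) (p : N) : Prop :=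
  ∃ G : N → N, ContMDiffAt I I ∞ G (F p) ∧ G (F p) = p ∧ ∀ᶠ y in 𝓝 (F p), F (G y) = y

/-- If `G` inverts `Ψ_s` locally, then `G ∘ Ψ_{s-σ}` inverts `Ψ_σ`, because `Ψ_σ = Ψ_{σ-s} ∘ Ψ_s`.
Only the small time differences `±(s - σ)` have to be available. -/
theorem hasLocalInverse_of_sub (h : IsLocalFlow I Ψ D) {s σ : ℝ} {p : N} (hs : (s, p) ∈ D)
    (hσ : (σ, p) ∈ D) (h1 : (σ - s, Ψ s p) ∈ D) (h2 : (s - σ, Ψ σ p) ∈ D)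
    (hG : HasLocalInverse I (Ψ s) p) : HasLocalInverse I (Ψ σ) p := by
  obtain ⟨G, hG, hGp, hGy⟩ := hG
  have hsp : Ψ s p = Ψ (s - σ) (Ψ σ p) := h.map_sub hσ hs h2
  have hcont := h.continuousAt_time h2
  rw [ContinuousAt, ← hsp] at hcont
  have hGc := hG.continuousAt
  rw [ContinuousAt, hGp] at hGc
  refine ⟨G ∘ Ψ (s - σ), ContMDiffAt.comp _ (by rwa [← hsp]) (h.contMDiffAt_time h2), ?_, ?_⟩
  · rw [Function.comp_apply, ← hsp, hGp]
  · filter_upwards [hcont.eventually hGy, hcont.eventually (h.eventually_mem_time h1),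
      hcont.eventually (hGc.eventually (h.eventually_mem_time hs)),
      hcont.eventually (hGc.eventually (h.eventually_mem_time hσ)),
      h.eventually_mem_time h2] with y e1 e2 e3 e4 e5
    have := h.map_sub e3 e4 (by rwa [e1])
    rw [Function.comp_apply, this, e1, h.map_add (s - σ) (σ - s) y e5 e2 (by simp [h.zero_mem])]
    simp [h.map_zero]

theorem hasLocalInverse (h : IsLocalFlow I Ψ D) {s : ℝ} {p : N} (hs : (s, p) ∈ D) :
    HasLocalInverse I (Ψ s) p := by
  refine uIcc_induction (a := 0) (b := s) (Q := fun σ => HasLocalInverse I (Ψ σ) p)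
    (fun σ hσ => ?_) ?_
  · have hσp := h.mem_of_mem_uIcc hs hσ
    filter_upwards [nhdsWithin_le_nhds (h.eventually_mem_sub hσp),
      nhdsWithin_le_nhds (h.eventually_mem_sub' σ p),
      nhdsWithin_le_nhds (h.eventually_mem_orbit hσp)] with τ h1 h2 h3
    exact ⟨h.hasLocalInverse_of_sub hσp h3 h2 h1, h.hasLocalInverse_of_sub h3 hσp h1 h2⟩
  · have : Ψ 0 = id := funext h.map_zero
    exact ⟨id, contMDiffAt_id, by simp [this], by simp [this]⟩

theorem isOpen_timeDomain (h : IsLocalFlow I Ψ D) (s : ℝ) : IsOpen (timeDomain D s) :=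
  h.isOpen.preimage (by fun_prop : Continuous fun q : N => (s, q))

theorem isOpen_image (h : IsLocalFlow I Ψ D) (s : ℝ) : IsOpen (Ψ s '' timeDomain D s) := by
  rw [isOpen_iff_mem_nhds]
  rintro _ ⟨p, hp, rfl⟩
  obtain ⟨G, hG, hGp, hGy⟩ := h.hasLocalInverse hp
  have hGc := hG.continuousAt
  rw [ContinuousAt, hGp] at hGc
  filter_upwards [hGy, hGc.eventually (h.eventually_mem_time hp)] with y h1 h2
  exact ⟨G y, h2, h1⟩

theorem exists_smooth_inverse (h : IsLocalFlow I Ψ D) (s : ℝ) :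
    ∃ G : N → N, ContMDiffOn I I ∞ G (Ψ s '' timeDomain D s) ∧
      LeftInvOn G (Ψ s) (timeDomain D s) := by
  rcases isEmpty_or_nonempty N with hN | hN
  · exact ⟨id, contMDiffOn_id, fun p => (hN.false p).elim⟩
  have hinv : LeftInvOn (Function.invFunOn (Ψ s) (timeDomain D s)) (Ψ s) (timeDomain D s) :=
    (h.injOn s).leftInvOn_invFunOn
  refine ⟨_, ?_, hinv⟩
  rintro _ ⟨p, hp, rfl⟩
  obtain ⟨G, hG, hGp, hGy⟩ := h.hasLocalInverse hp
  have hGc := hG.continuousAt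
  rw [ContinuousAt, hGp] at hGc
  refine ContMDiffAt.contMDiffWithinAt (hG.congr_of_eventuallyEq ?_)
  filter_upwards [hGy, hGc.eventually (h.eventually_mem_time hp)] with y h1 h2
  -- The set-theoretic inverse agrees with the smooth local one: `G y` lies in `D_s` and is mapped
  -- to `y`.
  conv_lhs => rw [← h1]
  exact hinv h2

end IsLocalFlow

end Flow

/-! ### Low-degree alternating forms evaluated on explicit vectors -/

section Vec

variable {V W : Type*} [NormedAddCommGroup V] [NormedSpace ℝ V] [NormedAddCommGroup W]
  [NormedSpace ℝ W]

theorem compCLM_one (η : W [⋀^Fin 1]→L[ℝ] ℝ) (L : V →L[ℝ] W) (a : V) :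
    η.compContinuousLinearMap L ![a] = η ![L a] := by
  rw [ContinuousAlternatingMap.compContinuousLinearMap_apply]
  congr 1
  ext i
  fin_cases i
  rfl

theorem compCLM_two (η : W [⋀^Fin 2]→L[ℝ] ℝ) (L : V →L[ℝ] W) (a b : V) :
    η.compContinuousLinearMap L ![a, b] = η ![L a, L b] := by
  rw [ContinuousAlternatingMap.compContinuousLinearMap_apply]
  congr 1
  ext i
  fin_cases i <;> rfl

theorem compCLM_three (η : W [⋀^Fin 3]→L[ℝ] ℝ) (L : V →L[ℝ] W) (a b c : V) :
    η.compContinuousLinearMap L ![a, b, c] = η ![L a, L b, L c] := by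
  rw [ContinuousAlternatingMap.compContinuousLinearMap_apply]
  congr 1
  ext i
  fin_cases i <;> rfl

theorem wedgeLin_two (α : V [⋀^Fin 1]→L[ℝ] ℝ) (η : V [⋀^Fin 2]→L[ℝ] ℝ) (a b c : V) :
    wedgeLin α η ![a, b, c] =
      α ![a] * η ![b, c] - α ![b] * η ![a, c] + α ![c] * η ![a, b] := by
  have e1 : ∀ a : V, (fun _ : Fin 1 => a) = ![a] := fun a => by ext i; fin_cases i; rfl
  have r0 : (0 : Fin 3).removeNth ![a, b, c] = ![b, c] := by ext i; fin_cases i <;> rfl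
  have r1 : (1 : Fin 3).removeNth ![a, b, c] = ![a, c] := by ext i; fin_cases i <;> rfl
  have r2 : (2 : Fin 3).removeNth ![a, b, c] = ![a, b] := by ext i; fin_cases i <;> rfl
  rw [wedgeLin, ContinuousAlternatingMap.alternatizeUncurryFin_apply]
  refine (Fin.sum_univ_three _).trans ?_
  simp only [r0, r1, r2]
  simp [e1, -Fin.removeNth_zero]
  ring

theorem wedgeLin_one (α η : V [⋀^Fin 1]→L[ℝ] ℝ) (a b : V) :
    wedgeLin α η ![a, b] = α ![a] * η ![b] - α ![b] * η ![a] := by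
  have e1 : ∀ a : V, (fun _ : Fin 1 => a) = ![a] := fun a => by ext i; fin_cases i; rfl
  have r0 : (0 : Fin 2).removeNth ![a, b] = ![b] := by ext i; fin_cases i; rfl
  have r1 : (1 : Fin 2).removeNth ![a, b] = ![a] := by ext i; fin_cases i; rfl
  rw [wedgeLin, ContinuousAlternatingMap.alternatizeUncurryFin_apply]
  refine (Fin.sum_univ_two _).trans ?_
  simp only [r0, r1]
  simp [e1, -Fin.removeNth_zero]
  ring

theorem ext_one {α β : V [⋀^Fin 1]→L[ℝ] ℝ} (h : ∀ a, α ![a] = β ![a]) : α = β := by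
  ext v
  convert h (v 0) using 2 <;> (ext i; fin_cases i; rfl)

theorem ext_two {α β : V [⋀^Fin 2]→L[ℝ] ℝ} (h : ∀ a b, α ![a, b] = β ![a, b]) : α = β := by
  ext v
  convert h (v 0) (v 1) using 2 <;> (ext i; fin_cases i <;> rfl)

end Vec

/-! ### Chart expressions of forms on `M` -/

section Chart

variable {E : Type*} [NormedAddCommGroup E] [NormedSpace ℝ E]
  {M : Type*} [TopologicalSpace M] [ChartedSpace E M]

/-- The inverse of the chart `(t, x) ↦ (t, e x)` of `ℝ × M`, `e` the preferred chart at `x₀`. -/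
def chartInv (x₀ : M) (z : ℝ × E) : ℝ × M := (z.1, (extChartAt 𝓘(ℝ, E) x₀).symm z.2)

/-- The chart `(t, x) ↦ (t, e x)` of `ℝ × M`, with `e` the preferred chart at `x₀`. -/
def chartMap (x₀ : M) (p : ℝ × M) : ℝ × E := (p.1, extChartAt 𝓘(ℝ, E) x₀ p.2)

theorem chartMap_chartInv {x₀ : M} {z : ℝ × E} (hz : z.2 ∈ (extChartAt 𝓘(ℝ, E) x₀).target) :
    chartMap x₀ (chartInv x₀ z) = z :=
  Prod.ext rfl ((extChartAt 𝓘(ℝ, E) x₀).right_inv hz)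

theorem chartInv_chartMap {x₀ : M} {p : ℝ × M} (hp : p.2 ∈ (extChartAt 𝓘(ℝ, E) x₀).source) :
    chartInv x₀ (chartMap (E := E) x₀ p) = p :=
  Prod.ext rfl ((extChartAt 𝓘(ℝ, E) x₀).left_inv hp)

theorem eventually_mem_target {x₀ : M} {z : ℝ × E}
    (hz : z.2 ∈ (extChartAt 𝓘(ℝ, E) x₀).target) :
    ∀ᶠ z' in 𝓝 z, z'.2 ∈ (extChartAt 𝓘(ℝ, E) x₀).target :=
  continuousAt_snd.eventually ((isOpen_extChartAt_target x₀).mem_nhds hz)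

variable [IsManifold 𝓘(ℝ, E) ∞ M]

theorem contMDiffAt_chart {x₀ x : M} (hx : x ∈ (extChartAt 𝓘(ℝ, E) x₀).source) :
    ContMDiffAt 𝓘(ℝ, E) 𝓘(ℝ, E) ∞ (extChartAt 𝓘(ℝ, E) x₀) x :=
  contMDiffAt_extChartAt' (by simpa using hx)

theorem contMDiffAt_chart_symm {x₀ : M} {y : E} (hy : y ∈ (extChartAt 𝓘(ℝ, E) x₀).target) :
    ContMDiffAt 𝓘(ℝ, E) 𝓘(ℝ, E) ∞ (extChartAt 𝓘(ℝ, E) x₀).symm y :=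
  (contMDiffOn_extChartAt_symm x₀).contMDiffAt ((isOpen_extChartAt_target x₀).mem_nhds hy)

theorem contMDiffAt_chartInv {x₀ : M} {z : ℝ × E}
    (hz : z.2 ∈ (extChartAt 𝓘(ℝ, E) x₀).target) :
    ContMDiffAt 𝓘(ℝ, ℝ × E) (extModel E) ∞ (chartInv x₀) z :=
  contDiff_fst.contMDiff.contMDiffAt.prodMk
    ((contMDiffAt_chart_symm hz).comp z contDiff_snd.contMDiff.contMDiffAt)

theorem contMDiffAt_chartMap {x₀ : M} {p : ℝ × M}
    (hp : p.2 ∈ (extChartAt 𝓘(ℝ, E) x₀).source) :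
    ContMDiffAt (extModel E) 𝓘(ℝ, ℝ × E) ∞ (chartMap (E := E) x₀) p :=
  contMDiffAt_fst.prodMk_space ((contMDiffAt_chart hp).comp p contMDiffAt_snd)

theorem mfderiv_symm_mfderiv {x₀ x : M} (hx : x ∈ (extChartAt 𝓘(ℝ, E) x₀).source) (v : E) :
    mfderiv 𝓘(ℝ, E) 𝓘(ℝ, E) (extChartAt 𝓘(ℝ, E) x₀).symm (extChartAt 𝓘(ℝ, E) x₀ x)
      (mfderiv 𝓘(ℝ, E) 𝓘(ℝ, E) (extChartAt 𝓘(ℝ, E) x₀) x v) = v := by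
  have h1 := (contMDiffAt_chart hx).mdifferentiableAt (by simp)
  have h2 := (contMDiffAt_chart_symm ((extChartAt 𝓘(ℝ, E) x₀).map_source hx)).mdifferentiableAt
    (by simp)
  have h3 := mfderiv_comp x h2 h1
  have h4 : (extChartAt 𝓘(ℝ, E) x₀).symm ∘ extChartAt 𝓘(ℝ, E) x₀ =ᶠ[𝓝 x] id := by
    filter_upwards [(isOpen_extChartAt_source x₀).mem_nhds hx] with y hy
    exact (extChartAt 𝓘(ℝ, E) x₀).left_inv hy
  have h5 := h4.mfderiv_eq (I := 𝓘(ℝ, E)) (I' := 𝓘(ℝ, E))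
  rw [mfderiv_id, h3] at h5
  exact DFunLike.congr_fun h5 v

/-- The derivative of `chartInv x₀` at `z`. -/
def chartFrame (x₀ : M) (z : ℝ × E) : ℝ × E →L[ℝ] ℝ × E :=
  mfderiv 𝓘(ℝ, ℝ × E) (extModel E) (chartInv x₀) z

/-- `chartInv ∘ chartMap` is the identity near the point, so the derivative has a right inverse.
Identities between forms can thus be tested on the vectors `chartFrame x₀ z v`. -/
theorem chartFrame_surjective {x₀ : M} {z : ℝ × E}
    (hz : z.2 ∈ (extChartAt 𝓘(ℝ, E) x₀).target) : Function.Surjective (chartFrame x₀ z) := by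
  have hs : (chartInv x₀ z).2 ∈ (extChartAt 𝓘(ℝ, E) x₀).source :=
    (extChartAt 𝓘(ℝ, E) x₀).map_target hz
  have hz' := chartMap_chartInv hz
  have h1 := (contMDiffAt_chartMap (E := E) hs).mdifferentiableAt (by simp)
  have h2 := (contMDiffAt_chartInv hz).mdifferentiableAt (by simp)
  have h4 : chartInv x₀ ∘ chartMap (E := E) x₀ =ᶠ[𝓝 (chartInv x₀ z)] id := by
    filter_upwards [continuousAt_snd.eventually
      ((isOpen_extChartAt_source x₀).mem_nhds hs)] with y hy
    exact chartInv_chartMap hy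
  have h5 := h4.mfderiv_eq (I := extModel E) (I' := extModel E)
  rw [mfderiv_id, mfderiv_comp (I' := 𝓘(ℝ, ℝ × E)) _ (by rwa [hz']) h1] at h5
  intro v
  refine ⟨mfderiv (extModel E) 𝓘(ℝ, ℝ × E) (chartMap (E := E) x₀) (chartInv x₀ z) v, ?_⟩
  have h6 := DFunLike.congr_fun h5 v
  rw [hz'] at h6
  exact h6

/-- A form expressed through its chart expression. -/
theorem form_eq_inChart {k : ℕ} (η : DForm 𝓘(ℝ, E) M k) {x₀ x : M}
    (hx : x ∈ (extChartAt 𝓘(ℝ, E) x₀).source) :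
    η x = (inChart η x₀ (extChartAt 𝓘(ℝ, E) x₀ x)).compContinuousLinearMap
      (mfderiv 𝓘(ℝ, E) 𝓘(ℝ, E) (extChartAt 𝓘(ℝ, E) x₀) x) := by
  -- Going through the chart and back returns `x` only up to a propositional equality; a free base
  -- point `y` allows it to be substituted in the dependent fibre.
  have key : ∀ (y : M) (L : E →L[ℝ] E), y = x → (∀ v, L v = v) → ∀ v : Fin k → E,
      (η x : E [⋀^Fin k]→L[ℝ] ℝ) v = (η y : E [⋀^Fin k]→L[ℝ] ℝ) (fun i => L (v i)) := by
    rintro y L rfl hL v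
    simp [hL]
  refine ContinuousAlternatingMap.ext fun v => ?_
  exact key _ ((mfderiv 𝓘(ℝ, E) 𝓘(ℝ, E) (extChartAt 𝓘(ℝ, E) x₀).symm
    (extChartAt 𝓘(ℝ, E) x₀ x)).comp (mfderiv 𝓘(ℝ, E) 𝓘(ℝ, E) (extChartAt 𝓘(ℝ, E) x₀) x))
    ((extChartAt 𝓘(ℝ, E) x₀).left_inv hx) (mfderiv_symm_mfderiv hx) v

/-- The chart expression of a form is compatible with a change of chart. -/
theorem inChart_eq_pullback {k : ℕ} (η : DForm 𝓘(ℝ, E) M k) {x₀ x₁ : M} {y : E}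
    (hy : y ∈ (extChartAt 𝓘(ℝ, E) x₀).target)
    (hy' : (extChartAt 𝓘(ℝ, E) x₀).symm y ∈ (extChartAt 𝓘(ℝ, E) x₁).source) :
    inChart η x₀ y =
      (inChart η x₁ ((extChartAt 𝓘(ℝ, E) x₁ ∘ (extChartAt 𝓘(ℝ, E) x₀).symm) y)).compContinuousLinearMap
        (fderiv ℝ (extChartAt 𝓘(ℝ, E) x₁ ∘ (extChartAt 𝓘(ℝ, E) x₀).symm) y) := by
  have h1 := (contMDiffAt_chart hy').mdifferentiableAt (by simp)
  have h2 := (contMDiffAt_chart_symm hy).mdifferentiableAt (by simp)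
  rw [← mfderiv_eq_fderiv, mfderiv_comp _ h1 h2]
  have h3 := form_eq_inChart η hy'
  refine ContinuousAlternatingMap.ext fun v => ?_
  exact DFunLike.congr_fun h3 _

/-- `extD` is computed at each point in that point's own chart. Naturality of `extDeriv` under the
transition map carries the result to one fixed chart `x₀`. -/
theorem extDeriv_inChart {k : ℕ} {η : DForm 𝓘(ℝ, E) M k} (hη : IsSmoothForm η) {x₀ : M} {y : E}
    (hy : y ∈ (extChartAt 𝓘(ℝ, E) x₀).target) :
    extDeriv (inChart η x₀) y = (extD η ((extChartAt 𝓘(ℝ, E) x₀).symm y)).compContinuousLinearMap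
      (mfderiv 𝓘(ℝ, E) 𝓘(ℝ, E) (extChartAt 𝓘(ℝ, E) x₀).symm y) := by
  set x := (extChartAt 𝓘(ℝ, E) x₀).symm y with hx
  have hxs : x ∈ (extChartAt 𝓘(ℝ, E) x).source := mem_extChartAt_source x
  have h1 := contMDiffAt_chart hxs
  have h2 := contMDiffAt_chart_symm hy
  have hτ : ContDiffAt ℝ ∞ (extChartAt 𝓘(ℝ, E) x ∘ (extChartAt 𝓘(ℝ, E) x₀).symm) y :=
    contMDiffAt_iff_contDiffAt.1 (h1.comp y h2)
  have hηd : DifferentiableAt ℝ (inChart η x) (extChartAt 𝓘(ℝ, E) x x) :=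
    ((hη x).contDiffAt (extChartAt_target_mem_nhds x)).differentiableAt (by simp)
  have hfd : fderiv ℝ (extChartAt 𝓘(ℝ, E) x ∘ (extChartAt 𝓘(ℝ, E) x₀).symm) y =
      (mfderiv 𝓘(ℝ, E) 𝓘(ℝ, E) (extChartAt 𝓘(ℝ, E) x) x : E →L[ℝ] E).comp
        (mfderiv 𝓘(ℝ, E) 𝓘(ℝ, E) (extChartAt 𝓘(ℝ, E) x₀).symm y : E →L[ℝ] E) :=
    mfderiv_eq_fderiv.symm.trans
      (mfderiv_comp y (h1.mdifferentiableAt (by simp)) (h2.mdifferentiableAt (by simp)))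
  have h3 : inChart η x₀ =ᶠ[𝓝 y] fun y =>
      (inChart η x ((extChartAt 𝓘(ℝ, E) x ∘ (extChartAt 𝓘(ℝ, E) x₀).symm) y)).compContinuousLinearMap
        (fderiv ℝ (extChartAt 𝓘(ℝ, E) x ∘ (extChartAt 𝓘(ℝ, E) x₀).symm) y) := by
    filter_upwards [(isOpen_extChartAt_target x₀).mem_nhds hy,
      h2.continuousAt.eventually (extChartAt_source_mem_nhds (I := 𝓘(ℝ, E)) x)] with z hz hz'
    exact inChart_eq_pullback η hz hz'
  rw [h3.extDeriv_eq, extDeriv_pullback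
    (f := extChartAt 𝓘(ℝ, E) x ∘ (extChartAt 𝓘(ℝ, E) x₀).symm) hηd hτ (by simpa using two_le_infty),
    hfd]
  rfl

theorem extDeriv_inChart_lee {Ω : DForm 𝓘(ℝ, E) M 2} {θ : DForm 𝓘(ℝ, E) M 1} (h : IsLCS Ω θ)
    {x₀ : M} {y : E} (hy : y ∈ (extChartAt 𝓘(ℝ, E) x₀).target) :
    extDeriv (inChart θ x₀) y = 0 := by
  rw [extDeriv_inChart h.smooth_lee hy, h.closed_lee]
  rfl

theorem extDeriv_inChart_form {Ω : DForm 𝓘(ℝ, E) M 2} {θ : DForm 𝓘(ℝ, E) M 1} (h : IsLCS Ω θ)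
    {x₀ : M} {y : E} (hy : y ∈ (extChartAt 𝓘(ℝ, E) x₀).target) (a b c : E) :
    extDeriv (inChart Ω x₀) y ![a, b, c] =
      inChart θ x₀ y ![a] * inChart Ω x₀ y ![b, c] - inChart θ x₀ y ![b] * inChart Ω x₀ y ![a, c] +
        inChart θ x₀ y ![c] * inChart Ω x₀ y ![a, b] := by
  rw [extDeriv_inChart h.smooth_form hy, h.extD_form]
  refine (compCLM_three (V := E) (W := E) _ _ _ _ _).trans ?_
  refine (wedgeLin_two (V := E) _ _ _ _ _).trans ?_
  let L : E →L[ℝ] E := mfderiv 𝓘(ℝ, E) 𝓘(ℝ, E) (extChartAt 𝓘(ℝ, E) x₀).symm y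
  have e1 : ∀ a, inChart θ x₀ y ![a] =
      (θ ((extChartAt 𝓘(ℝ, E) x₀).symm y) : E [⋀^Fin 1]→L[ℝ] ℝ) ![L a] := fun a =>
    compCLM_one (V := E) (W := E) _ L a
  have e2 : ∀ a b, inChart Ω x₀ y ![a, b] =
      (Ω ((extChartAt 𝓘(ℝ, E) x₀).symm y) : E [⋀^Fin 2]→L[ℝ] ℝ) ![L a, L b] := fun a b =>
    compCLM_two (V := E) (W := E) _ L a b
  rw [e1, e1, e1, e2, e2, e2]
  rfl

end Chart

/-! ### Forms and functions on `ℝ × M` in product charts -/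

section Extended

variable {E : Type*} [NormedAddCommGroup E] [NormedSpace ℝ E]
  {M : Type*} [TopologicalSpace M] [ChartedSpace E M]

/-- The value of a form on `ℝ × M` at a point, as an alternating map on `ℝ × E`. -/
def ev {k : ℕ} (η : DForm (extModel E) (ℝ × M) k) (p : ℝ × M) : (ℝ × E) [⋀^Fin k]→L[ℝ] ℝ := η p

/-- The value of a vector field on `ℝ × M` at a point, as an element of `ℝ × E`. -/
def vec (X : (p : ℝ × M) → TangentSpace (extModel E) p) (p : ℝ × M) : ℝ × E := X p

/-- The differential of a real function on `ℝ × M` at a point, as a linear form on `ℝ × E`. -/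
def diff (f : ℝ × M → ℝ) (p : ℝ × M) : ℝ × E →L[ℝ] ℝ := mfderiv (extModel E) 𝓘(ℝ, ℝ) f p

/-- The derivative of a self-map of `ℝ × M` at a point, as a linear map of `ℝ × E`. -/
def tmap (F : ℝ × M → ℝ × M) (p : ℝ × M) : ℝ × E →L[ℝ] ℝ × E :=
  mfderiv (extModel E) (extModel E) F p

/-- The space coordinates of a point of `ℝ × M` in the preferred chart at `x₀`. -/
def spaceChart (x₀ : M) (p : ℝ × M) : E := extChartAt 𝓘(ℝ, E) x₀ p.2

/-- The derivative of `spaceChart x₀` at `p`. -/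
def spaceFrame (x₀ : M) (p : ℝ × M) : ℝ × E →L[ℝ] E :=
  mfderiv (extModel E) 𝓘(ℝ, E) (spaceChart (E := E) x₀) p

/-- The space component of a flow on `ℝ × M`, read in the preferred chart at `x₀`. -/
def flowChart (x₀ : M) (Ψ : ℝ → ℝ × M → ℝ × M) (w : ℝ × (ℝ × E)) : E :=
  spaceChart x₀ (Ψ w.1 (chartInv x₀ w.2))

theorem spaceChart_chartInv {x₀ : M} {z : ℝ × E}
    (hz : z.2 ∈ (extChartAt 𝓘(ℝ, E) x₀).target) : spaceChart x₀ (chartInv x₀ z) = z.2 :=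
  (extChartAt 𝓘(ℝ, E) x₀).right_inv hz

theorem chartInv_mem_source {x₀ : M} {z : ℝ × E}
    (hz : z.2 ∈ (extChartAt 𝓘(ℝ, E) x₀).target) :
    (chartInv x₀ z).2 ∈ (extChartAt 𝓘(ℝ, E) x₀).source :=
  (extChartAt 𝓘(ℝ, E) x₀).map_target hz

theorem exists_chartInv_eq (p : ℝ × M) : ∃ (x₀ : M) (z : ℝ × E),
    z.2 ∈ (extChartAt 𝓘(ℝ, E) x₀).target ∧ chartInv x₀ z = p :=
  ⟨p.2, chartMap p.2 p, mem_extChartAt_target p.2,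
    chartInv_chartMap (mem_extChartAt_source p.2)⟩

theorem dt_apply (p : ℝ × M) (v : ℝ × E) :
    ev (dt E M) p ![v] = v.1 := by
  change (mfderiv (extModel E) 𝓘(ℝ, ℝ) (Prod.fst : ℝ × M → ℝ) p) v = v.1
  rw [mfderiv_fst]
  rfl

theorem dFun_apply (f : ℝ × M → ℝ) (p : ℝ × M) (v : ℝ × E) :
    ev (dFun (I := extModel E) f) p ![v] = diff f p v := rfl

theorem interiorProd_apply {k : ℕ} (X : (p : ℝ × M) → TangentSpace (extModel E) p)
    (η : DForm (extModel E) (ℝ × M) (k + 1)) (p : ℝ × M) (v : Fin k → ℝ × E) :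
    ev (interiorProd X η) p v = ev η p (Matrix.vecCons (vec X p) v) := rfl

theorem partialT_chartInv {f : ℝ × M → ℝ} {x₀ : M} {z : ℝ × E}
    (hf : DifferentiableAt ℝ (f ∘ chartInv x₀) z) :
    partialT f (chartInv x₀ z) = fderiv ℝ (f ∘ chartInv x₀) z (1, 0) :=
  (hasDerivAt_slice hf).deriv

variable [IsManifold 𝓘(ℝ, E) ∞ M]

theorem contMDiffAt_spaceChart {x₀ : M} {p : ℝ × M}
    (hp : p.2 ∈ (extChartAt 𝓘(ℝ, E) x₀).source) :
    ContMDiffAt (extModel E) 𝓘(ℝ, E) ∞ (spaceChart (E := E) x₀) p :=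
  (contMDiffAt_chart hp).comp p contMDiffAt_snd

theorem hat_eq_inChart {k : ℕ} (η : DForm 𝓘(ℝ, E) M k) {x₀ : M} {p : ℝ × M}
    (hp : p.2 ∈ (extChartAt 𝓘(ℝ, E) x₀).source) :
    ev (hat η) p =
      (inChart η x₀ (spaceChart x₀ p)).compContinuousLinearMap (spaceFrame x₀ p) := by
  have h1 : spaceFrame x₀ p = (mfderiv 𝓘(ℝ, E) 𝓘(ℝ, E) (extChartAt 𝓘(ℝ, E) x₀) p.2 :
      E →L[ℝ] E).comp (mfderiv (extModel E) 𝓘(ℝ, E) (Prod.snd : ℝ × M → M) p :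
        ℝ × E →L[ℝ] E) :=
    mfderiv_comp p ((contMDiffAt_chart hp).mdifferentiableAt (by simp)) mdifferentiableAt_snd
  have h2 := form_eq_inChart η hp
  refine ContinuousAlternatingMap.ext fun v => ?_
  rw [h1]
  exact DFunLike.congr_fun h2 _

theorem spaceFrame_chartFrame {x₀ : M} {z : ℝ × E}
    (hz : z.2 ∈ (extChartAt 𝓘(ℝ, E) x₀).target) (v : ℝ × E) :
    spaceFrame x₀ (chartInv x₀ z) (chartFrame x₀ z v) = v.2 := by
  have h1 := (contMDiffAt_spaceChart (chartInv_mem_source hz)).mdifferentiableAt (by simp)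
  have h2 := (contMDiffAt_chartInv hz).mdifferentiableAt (by simp)
  have h3 : spaceChart x₀ ∘ chartInv x₀ =ᶠ[𝓝 z] Prod.snd := by
    filter_upwards [eventually_mem_target hz] with y hy
    exact spaceChart_chartInv hy
  have h4 := h3.mfderiv_eq (I := 𝓘(ℝ, ℝ × E)) (I' := 𝓘(ℝ, E))
  rw [mfderiv_comp _ h1 h2, mfderiv_eq_fderiv, fderiv_snd] at h4
  exact DFunLike.congr_fun h4 v

theorem hat_one_chartFrame (η : DForm 𝓘(ℝ, E) M 1) {x₀ : M} {z : ℝ × E}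
    (hz : z.2 ∈ (extChartAt 𝓘(ℝ, E) x₀).target) (v : ℝ × E) :
    ev (hat η) (chartInv x₀ z) ![chartFrame x₀ z v] =
      inChart η x₀ z.2 ![v.2] := by
  rw [hat_eq_inChart η (chartInv_mem_source hz), compCLM_one, spaceFrame_chartFrame hz,
    spaceChart_chartInv hz]

theorem contDiffAt_comp_chartInv {f : ℝ × M → ℝ} {x₀ : M} {z : ℝ × E}
    (hz : z.2 ∈ (extChartAt 𝓘(ℝ, E) x₀).target)
    (hf : ContMDiffAt (extModel E) 𝓘(ℝ, ℝ) ∞ f (chartInv x₀ z)) :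
    ContDiffAt ℝ ∞ (f ∘ chartInv x₀) z :=
  contMDiffAt_iff_contDiffAt.1 (hf.comp z (contMDiffAt_chartInv hz))

theorem contMDiffAt_of_comp_chartInv {f : ℝ × M → ℝ} {x₀ : M} {z : ℝ × E}
    (hz : z.2 ∈ (extChartAt 𝓘(ℝ, E) x₀).target)
    (hf : ContDiffAt ℝ ∞ (f ∘ chartInv x₀) z) :
    ContMDiffAt (extModel E) 𝓘(ℝ, ℝ) ∞ f (chartInv x₀ z) := by
  have hs := chartInv_mem_source hz
  have h1 : ContMDiffAt (extModel E) 𝓘(ℝ, ℝ) ∞ ((f ∘ chartInv x₀) ∘ chartMap (E := E) x₀)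
      (chartInv x₀ z) :=
    ContMDiffAt.comp _ (by rw [chartMap_chartInv hz]; exact contMDiffAt_iff_contDiffAt.2 hf)
      (contMDiffAt_chartMap hs)
  refine h1.congr_of_eventuallyEq ?_
  filter_upwards [continuousAt_snd.eventually ((isOpen_extChartAt_source x₀).mem_nhds hs)]
    with p hp
  simp only [Function.comp_apply]
  rw [chartInv_chartMap hp]

theorem mfderiv_chartFrame {f : ℝ × M → ℝ} {x₀ : M} {z : ℝ × E}
    (hz : z.2 ∈ (extChartAt 𝓘(ℝ, E) x₀).target)
    (hf : MDifferentiableAt (extModel E) 𝓘(ℝ, ℝ) f (chartInv x₀ z)) (v : ℝ × E) :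
    diff f (chartInv x₀ z) (chartFrame x₀ z v) =
      fderiv ℝ (f ∘ chartInv x₀) z v := by
  have h := mfderiv_comp z hf ((contMDiffAt_chartInv hz).mdifferentiableAt (by simp))
  rw [mfderiv_eq_fderiv] at h
  exact (DFunLike.congr_fun h v).symm

theorem dt_chartFrame {x₀ : M} {z : ℝ × E} (hz : z.2 ∈ (extChartAt 𝓘(ℝ, E) x₀).target)
    (v : ℝ × E) : (chartFrame x₀ z v).1 = v.1 := by
  have h := mfderiv_chartFrame (f := Prod.fst) hz mdifferentiableAt_fst v
  rw [diff, mfderiv_fst] at h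
  refine Eq.trans h ?_
  have : (Prod.fst ∘ chartInv x₀ : ℝ × E → ℝ) = Prod.fst := rfl
  rw [this, fderiv_fst]
  rfl

theorem contMDiffAt_partialT {f : ℝ × M → ℝ} {S : Set (ℝ × M)} (hS : IsOpen S)
    (hf : ContMDiffOn (extModel E) 𝓘(ℝ, ℝ) ∞ f S) {p : ℝ × M} (hp : p ∈ S) :
    ContMDiffAt (extModel E) 𝓘(ℝ, ℝ) ∞ (partialT f) p := by
  obtain ⟨x₀, z, hz, rfl⟩ := exists_chartInv_eq (E := E) p
  refine contMDiffAt_of_comp_chartInv hz ?_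
  have hfz := contDiffAt_comp_chartInv hz (hf.contMDiffAt (hS.mem_nhds hp))
  have h1 : ContDiffAt ℝ ∞ (fun z => fderiv ℝ (f ∘ chartInv x₀) z (1, 0)) z :=
    (hfz.fderiv_right (m := ∞) le_rfl).clm_apply contDiffAt_const
  refine h1.congr_of_eventuallyEq ?_
  filter_upwards [eventually_mem_target hz,
    (contMDiffAt_chartInv hz).continuousAt.eventually (hS.mem_nhds hp)] with y hy hyS
  exact partialT_chartInv ((contDiffAt_comp_chartInv hy
    (hf.contMDiffAt (hS.mem_nhds hyS))).differentiableAt (by simp))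

end Extended

/-! ### Lie derivatives of `θ̂` and `Ω̂` at time zero -/

section FlowChart

variable {E : Type*} [NormedAddCommGroup E] [NormedSpace ℝ E]
  {M : Type*} [TopologicalSpace M] [ChartedSpace E M]
  {Ψ : ℝ → ℝ × M → ℝ × M} {D : Set (ℝ × (ℝ × M))}

theorem flowChart_zero (h : IsLocalFlow (extModel E) Ψ D) {x₀ : M} {z : ℝ × E}
    (hz : z.2 ∈ (extChartAt 𝓘(ℝ, E) x₀).target) : flowChart x₀ Ψ (0, z) = z.2 := by
  simp only [flowChart]
  rw [h.map_zero, spaceChart_chartInv hz]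

theorem eventually_flow_mem (h : IsLocalFlow (extModel E) Ψ D) {x₀ : M} {z : ℝ × E}
    (hz : z.2 ∈ (extChartAt 𝓘(ℝ, E) x₀).target) :
    ∀ᶠ r in 𝓝 (0 : ℝ), (r, chartInv x₀ z) ∈ D ∧
      (Ψ r (chartInv x₀ z)).2 ∈ (extChartAt 𝓘(ℝ, E) x₀).source := by
  refine (h.eventually_mem_orbit (h.zero_mem _)).and ?_
  refine (continuousAt_snd.comp (h.continuousAt_orbit (h.zero_mem (chartInv x₀ z)))).eventually
    ((isOpen_extChartAt_source x₀).mem_nhds ?_)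
  simp only [Function.comp_apply]
  rw [h.map_zero]
  exact chartInv_mem_source hz

variable [IsManifold 𝓘(ℝ, E) ∞ M]

theorem contDiffAt_comp_flow (h : IsLocalFlow (extModel E) Ψ D) {G : Type*} [NormedAddCommGroup G]
    [NormedSpace ℝ G] {g : ℝ × M → G} {x₀ : M} {r : ℝ} {z : ℝ × E}
    (hz : z.2 ∈ (extChartAt 𝓘(ℝ, E) x₀).target) (hr : (r, chartInv x₀ z) ∈ D)
    (hg : ContMDiffAt (extModel E) 𝓘(ℝ, G) ∞ g (Ψ r (chartInv x₀ z))) :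
    ContDiffAt ℝ ∞ (fun w : ℝ × (ℝ × E) => g (Ψ w.1 (chartInv x₀ w.2))) (r, z) := by
  have h1 : ContMDiffAt 𝓘(ℝ, ℝ × (ℝ × E)) (𝓘(ℝ, ℝ).prod (extModel E)) ∞
      (fun w : ℝ × (ℝ × E) => (w.1, chartInv x₀ w.2)) (r, z) :=
    contDiff_fst.contMDiff.contMDiffAt.prodMk
      (ContMDiffAt.comp (r, z) (contMDiffAt_chartInv hz) contDiff_snd.contMDiff.contMDiffAt)
  have h2 := ContMDiffAt.comp (r, z) (h.contMDiffAt hr) h1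
  exact contMDiffAt_iff_contDiffAt.1 (ContMDiffAt.comp (r, z) hg h2)

theorem contDiffAt_flowChart (h : IsLocalFlow (extModel E) Ψ D) {x₀ : M} {r : ℝ} {z : ℝ × E}
    (hz : z.2 ∈ (extChartAt 𝓘(ℝ, E) x₀).target) (hr : (r, chartInv x₀ z) ∈ D)
    (hs : (Ψ r (chartInv x₀ z)).2 ∈ (extChartAt 𝓘(ℝ, E) x₀).source) :
    ContDiffAt ℝ ∞ (flowChart (E := E) x₀ Ψ) (r, z) :=
  contDiffAt_comp_flow h hz hr (contMDiffAt_spaceChart hs)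

theorem contDiffAt_flowChart_zero (h : IsLocalFlow (extModel E) Ψ D) {x₀ : M} {z : ℝ × E}
    (hz : z.2 ∈ (extChartAt 𝓘(ℝ, E) x₀).target) :
    ContDiffAt ℝ ∞ (flowChart (E := E) x₀ Ψ) (0, z) :=
  contDiffAt_flowChart h hz (h.zero_mem _) (by rw [h.map_zero]; exact chartInv_mem_source hz)

theorem fderiv_flowChart_space (h : IsLocalFlow (extModel E) Ψ D) {x₀ : M} {z : ℝ × E}
    (hz : z.2 ∈ (extChartAt 𝓘(ℝ, E) x₀).target) (v : ℝ × E) :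
    fderiv ℝ (flowChart x₀ Ψ) (0, z) (0, v) = v.2 := by
  rw [fderiv_apply_prodMk_zero ((contDiffAt_flowChart_zero h hz).differentiableAt (by simp))]
  have h3 : (fun z => flowChart x₀ Ψ (0, z)) =ᶠ[𝓝 z] Prod.snd := by
    filter_upwards [eventually_mem_target hz] with y hy
    exact flowChart_zero h hy
  rw [h3.fderiv_eq, fderiv_snd]
  rfl

theorem fderiv_flowChart_time (h : IsLocalFlow (extModel E) Ψ D)
    {X : (p : ℝ × M) → TangentSpace (extModel E) p} (hX : IsGenerator (extModel E) Ψ X) {x₀ : M}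
    {z : ℝ × E} (hz : z.2 ∈ (extChartAt 𝓘(ℝ, E) x₀).target) :
    fderiv ℝ (flowChart x₀ Ψ) (0, z) (1, 0) =
      spaceFrame x₀ (chartInv x₀ z) (vec X (chartInv x₀ z)) := by
  have h1 := hasDerivAt_slice ((contDiffAt_flowChart_zero h hz).differentiableAt (by simp))
  have hs : (Ψ 0 (chartInv x₀ z)).2 ∈ (extChartAt 𝓘(ℝ, E) x₀).source := by
    rw [h.map_zero]; exact chartInv_mem_source hz
  have h2 := ((contMDiffAt_spaceChart hs).mdifferentiableAt (by simp)).hasMFDerivAt.comp 0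
    (hX (chartInv x₀ z))
  have h3 : HasFDerivAt (fun r => flowChart x₀ Ψ (r, z))
      ((spaceFrame x₀ (Ψ 0 (chartInv x₀ z))).comp
        ((1 : ℝ →L[ℝ] ℝ).smulRight (vec X (Ψ 0 (chartInv x₀ z))))) 0 :=
    hasMFDerivAt_iff_hasFDerivAt.1 h2
  rw [h1.unique h3.hasDerivAt, ContinuousLinearMap.comp_apply,
    ContinuousLinearMap.smulRight_apply, one_apply_eq_self, one_smul, h.map_zero]

/-- Reduces pullback by the flow to ordinary derivatives of `flowChart`, as long as the orbit stays
in the chart. Forms coming from `M` see only the space component of the flow. -/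
theorem pullback_flow_chartFrame (h : IsLocalFlow (extModel E) Ψ D) {k : ℕ}
    (η : DForm 𝓘(ℝ, E) M k) {x₀ : M} {r : ℝ} {z : ℝ × E}
    (hz : z.2 ∈ (extChartAt 𝓘(ℝ, E) x₀).target) (hr : (r, chartInv x₀ z) ∈ D)
    (hs : (Ψ r (chartInv x₀ z)).2 ∈ (extChartAt 𝓘(ℝ, E) x₀).source) :
    (ev (pullback (I := extModel E) (Ψ r) (hat η)) (chartInv x₀ z)).compContinuousLinearMap (chartFrame x₀ z) =
      (inChart η x₀ (flowChart x₀ Ψ (r, z))).compContinuousLinearMap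
        ((fderiv ℝ (flowChart x₀ Ψ) (r, z)).comp (ContinuousLinearMap.inr ℝ ℝ (ℝ × E))) := by
  have h1 : fderiv ℝ (fun z => flowChart x₀ Ψ (r, z)) z =
      (fderiv ℝ (flowChart x₀ Ψ) (r, z)).comp (ContinuousLinearMap.inr ℝ ℝ (ℝ × E)) :=
    (((contDiffAt_flowChart h hz hr hs).differentiableAt (by simp)).hasFDerivAt.comp z
      (hasFDerivAt_prodMk_right r z)).fderiv
  have d1 := (contMDiffAt_chartInv hz).mdifferentiableAt (by simp)
  have d2 := (h.contMDiffAt_time hr).mdifferentiableAt (by simp)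
  have d3 := (contMDiffAt_spaceChart hs).mdifferentiableAt (by simp)
  have h2 : fderiv ℝ (fun z => flowChart x₀ Ψ (r, z)) z =
      (spaceFrame x₀ (Ψ r (chartInv x₀ z))).comp
        ((tmap (E := E) (Ψ r) (chartInv x₀ z)).comp
          (chartFrame x₀ z)) := by
    refine mfderiv_eq_fderiv.symm.trans ?_
    refine (mfderiv_comp (I' := extModel E) (f := Ψ r ∘ chartInv x₀) (g := spaceChart x₀) z d3
      (d2.comp z d1)).trans ?_
    rw [mfderiv_comp z d2 d1]
    rfl
  rw [← h1, h2]
  have h3 := hat_eq_inChart η hs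
  refine ContinuousAlternatingMap.ext fun v => ?_
  exact DFunLike.congr_fun h3 _

variable {X : (p : ℝ × M) → TangentSpace (extModel E) p}

theorem interiorProd_hat_one (h : IsLocalFlow (extModel E) Ψ D)
    (hX : IsGenerator (extModel E) Ψ X) (η : DForm 𝓘(ℝ, E) M 1) {x₀ : M} {z : ℝ × E}
    (hz : z.2 ∈ (extChartAt 𝓘(ℝ, E) x₀).target) :
    ev (interiorProd X (hat η)) (chartInv x₀ z) ![] =
      inChart η x₀ z.2 ![fderiv ℝ (flowChart x₀ Ψ) (0, z) (1, 0)] := by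
  rw [interiorProd_apply, hat_eq_inChart η (chartInv_mem_source hz)]
  refine (compCLM_one _ _ _).trans ?_
  rw [spaceChart_chartInv hz, fderiv_flowChart_time h hX hz]

theorem interiorProd_hat_two (h : IsLocalFlow (extModel E) Ψ D)
    (hX : IsGenerator (extModel E) Ψ X) (η : DForm 𝓘(ℝ, E) M 2) {x₀ : M} {z : ℝ × E}
    (hz : z.2 ∈ (extChartAt 𝓘(ℝ, E) x₀).target) (v : ℝ × E) :
    ev (interiorProd X (hat η)) (chartInv x₀ z)
        ![chartFrame x₀ z v] =
      inChart η x₀ z.2 ![fderiv ℝ (flowChart x₀ Ψ) (0, z) (1, 0), v.2] := by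
  rw [interiorProd_apply, hat_eq_inChart η (chartInv_mem_source hz)]
  refine (compCLM_two _ _ _ _).trans ?_
  rw [spaceChart_chartInv hz, fderiv_flowChart_time h hX hz, spaceFrame_chartFrame hz]

/-- The Lie derivative of the pullback of a closed `1`-form vanishing on the generator is zero. -/
theorem hasDerivAt_pullback_lee (h : IsLocalFlow (extModel E) Ψ D)
    (hX : IsGenerator (extModel E) Ψ X) {Ω : DForm 𝓘(ℝ, E) M 2} {θ : DForm 𝓘(ℝ, E) M 1}
    (hLCS : IsLCS Ω θ) (hθ : interiorProd X (hat θ) = 0) {x₀ : M} {z : ℝ × E}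
    (hz : z.2 ∈ (extChartAt 𝓘(ℝ, E) x₀).target) (v : ℝ × E) :
    HasDerivAt (fun r => (ev (pullback (I := extModel E) (Ψ r) (hat θ)) (chartInv x₀ z))
      ![chartFrame x₀ z v]) 0 0 := by
  have hφ := contDiffAt_flowChart_zero h hz
  have h0 := flowChart_zero h hz
  have hd : DifferentiableAt ℝ (inChart θ x₀) (flowChart x₀ Ψ (0, z)) := by
    rw [h0]
    exact ((hLCS.smooth_lee x₀).contDiffAt
      ((isOpen_extChartAt_target x₀).mem_nhds hz)).differentiableAt (by simp)
  have h1 := hasDerivAt_pullback_one hφ hd v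
  -- The term `d(X ⌟ θ̂)` vanishes because the contraction is zero on a whole neighbourhood; the
  -- term `X ⌟ dθ̂` vanishes by closedness.
  have h2 : (fun z => inChart θ x₀ (flowChart x₀ Ψ (0, z))
      ![fderiv ℝ (flowChart x₀ Ψ) (0, z) (1, 0)]) =ᶠ[𝓝 z] fun _ => (0 : ℝ) := by
    filter_upwards [eventually_mem_target hz] with y hy
    rw [flowChart_zero h hy, ← interiorProd_hat_one h hX θ hy, hθ]
    rfl
  rw [h2.fderiv_eq, h0, extDeriv_inChart_lee hLCS hz] at h1
  refine (h1.congr_of_eventuallyEq ?_).congr_deriv (by simp)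
  filter_upwards [eventually_flow_mem h hz] with r hr
  have h3 := DFunLike.congr_fun (pullback_flow_chartFrame h θ hz hr.1 hr.2) ![v]
  rw [compCLM_one, compCLM_one] at h3
  exact h3

/-- The Lie derivative of the pullback of `Ω` along a flow whose generator is annihilated
by the Lee form. -/
theorem hasDerivAt_pullback_form (h : IsLocalFlow (extModel E) Ψ D)
    (hX : IsGenerator (extModel E) Ψ X) {Ω : DForm 𝓘(ℝ, E) M 2} {θ : DForm 𝓘(ℝ, E) M 1}
    (hLCS : IsLCS Ω θ) (hθ : interiorProd X (hat θ) = 0) {x₀ : M} {z : ℝ × E}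
    (hz : z.2 ∈ (extChartAt 𝓘(ℝ, E) x₀).target) (v w : ℝ × E)
    {b : ℝ × E → ℝ × E → ℝ} (hb : ∀ᶠ y in 𝓝 z, ∀ u, b y u =
      ev (interiorProd X (hat Ω)) (chartInv x₀ y)
        ![chartFrame x₀ y u]) :
    HasDerivAt (fun r => (ev (pullback (I := extModel E) (Ψ r) (hat Ω)) (chartInv x₀ z))
      ![chartFrame x₀ z v, chartFrame x₀ z w])
      (inChart θ x₀ z.2 ![w.2] * b z v - inChart θ x₀ z.2 ![v.2] * b z w +
        fderiv ℝ (fun y => b y w) z v - fderiv ℝ (fun y => b y v) z w) 0 := by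
  have hφ := contDiffAt_flowChart_zero h hz
  have h0 := flowChart_zero h hz
  have hd : DifferentiableAt ℝ (inChart Ω x₀) (flowChart x₀ Ψ (0, z)) := by
    rw [h0]
    exact ((hLCS.smooth_form x₀).contDiffAt
      ((isOpen_extChartAt_target x₀).mem_nhds hz)).differentiableAt (by simp)
  have h1 := hasDerivAt_pullback_two hφ hd v w
  have h2 : ∀ u, (fun z => inChart Ω x₀ (flowChart x₀ Ψ (0, z))
      ![fderiv ℝ (flowChart x₀ Ψ) (0, z) (1, 0), fderiv ℝ (flowChart x₀ Ψ) (0, z) (0, u)])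
        =ᶠ[𝓝 z] fun y => b y u := by
    intro u
    filter_upwards [eventually_mem_target hz, hb] with y hy hby
    rw [flowChart_zero h hy, hby, interiorProd_hat_two h hX Ω hy, fderiv_flowChart_space h hy]
  have h2' := fun u => (h2 u).eq_of_nhds
  simp only [h0, fderiv_flowChart_space h hz] at h2'
  -- In `X ⌟ (θ̂ ∧ Ω̂)` the summand `θ̂(X) Ω̂` drops out, leaving `-θ̂ ∧ (X ⌟ Ω̂)`.
  have h4 : inChart θ x₀ z.2 ![fderiv ℝ (flowChart x₀ Ψ) (0, z) (1, 0)] = 0 := by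
    rw [← interiorProd_hat_one h hX θ hz, hθ]
    rfl
  rw [(h2 w).fderiv_eq, (h2 v).fderiv_eq, h0, fderiv_flowChart_space h hz,
    fderiv_flowChart_space h hz, extDeriv_inChart_form hLCS hz, h2', h2', h4] at h1
  refine (h1.congr_of_eventuallyEq ?_).congr_deriv (by ring)
  filter_upwards [eventually_flow_mem h hz] with r hr
  have h3 := DFunLike.congr_fun (pullback_flow_chartFrame h Ω hz hr.1 hr.2) ![v, w]
  rw [compCLM_two, compCLM_two] at h3
  exact h3

end FlowChart

/-! ### Two calculus facts -/

section Integration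

variable {E : Type*} [NormedAddCommGroup E] [NormedSpace ℝ E]

theorem extDeriv_two_apply {κ : E → E [⋀^Fin 1]→L[ℝ] ℝ} {y : E} (hκ : DifferentiableAt ℝ κ y)
    (a b : E) : extDeriv κ y ![a, b] =
      fderiv ℝ (fun y => κ y ![b]) y a - fderiv ℝ (fun y => κ y ![a]) y b := by
  have r0 : (0 : Fin 2).removeNth ![a, b] = ![b] := by ext i; fin_cases i; rfl
  have r1 : (1 : Fin 2).removeNth ![a, b] = ![a] := by ext i; fin_cases i; rfl
  rw [extDeriv_apply hκ]
  refine (Fin.sum_univ_two _).trans ?_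
  simp only [r0, r1]
  simp [sub_eq_add_neg]

theorem eq_of_hasDerivAt_zero {B : ℝ → ℝ} {a b : ℝ} (h : ∀ σ ∈ uIcc a b, HasDerivAt B 0 σ) :
    B b = B a := by
  have := intervalIntegral.integral_eq_sub_of_hasDerivAt h intervalIntegrable_const
  simp at this
  linarith

end Integration

/-! ### Evolution of `t`, `θ̂` and `Ω̂` along the flow -/

section Preservation

variable {E : Type*} [NormedAddCommGroup E] [NormedSpace ℝ E]
  {M : Type*} [TopologicalSpace M] [ChartedSpace E M]
  {Ψ : ℝ → ℝ × M → ℝ × M} {D : Set (ℝ × (ℝ × M))}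
  {X : (p : ℝ × M) → TangentSpace (extModel E) p}

theorem ev_pullback {k : ℕ} (F : ℝ × M → ℝ × M) (η : DForm (extModel E) (ℝ × M) k)
    (p : ℝ × M) : ev (pullback (I := extModel E) F η) p =
      (ev η (F p)).compContinuousLinearMap (tmap F p) := rfl

theorem ev_pullback_flow_zero (h : IsLocalFlow (extModel E) Ψ D) {k : ℕ}
    (η : DForm (extModel E) (ℝ × M) k) (p : ℝ × M) :
    ev (pullback (I := extModel E) (Ψ 0) η) p = ev η p := by
  have h0 : Ψ 0 = id := funext h.map_zero
  have h1 : tmap (id : ℝ × M → ℝ × M) p = ContinuousLinearMap.id ℝ (ℝ × E) := mfderiv_id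
  rw [ev_pullback, h0, h1]
  rfl

theorem tmap_flow_sub (h : IsLocalFlow (extModel E) Ψ D) {σ τ : ℝ} {p : ℝ × M}
    (hσ : (σ, p) ∈ D) (hτ : (τ, p) ∈ D) (hr : (τ - σ, Ψ σ p) ∈ D) :
    tmap (E := E) (Ψ τ) p = (tmap (Ψ (τ - σ)) (Ψ σ p)).comp (tmap (Ψ σ) p) := by
  have h1 : Ψ τ =ᶠ[𝓝 p] Ψ (τ - σ) ∘ Ψ σ := h.eventually_map_sub hσ hτ hr
  exact (h1.mfderiv_eq (I := extModel E) (I' := extModel E)).trans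
    (mfderiv_comp p ((h.contMDiffAt_time hr).mdifferentiableAt (by simp))
      ((h.contMDiffAt_time hσ).mdifferentiableAt (by simp)))

/-- This cocycle identity converts a derivative of `Ψ_r^* η` at `r = 0`, taken at the point
`Ψ_σ(p)`, into the derivative at `r = σ`, taken at `p`. -/
theorem ev_pullback_flow_sub (h : IsLocalFlow (extModel E) Ψ D) {k : ℕ}
    (η : DForm (extModel E) (ℝ × M) k) {σ τ : ℝ} {p : ℝ × M}
    (hσ : (σ, p) ∈ D) (hτ : (τ, p) ∈ D) (hr : (τ - σ, Ψ σ p) ∈ D) :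
    ev (pullback (I := extModel E) (Ψ τ) η) p =
      (ev (pullback (I := extModel E) (Ψ (τ - σ)) η) (Ψ σ p)).compContinuousLinearMap
        (tmap (Ψ σ) p) := by
  rw [ev_pullback, tmap_flow_sub h hσ hτ hr, ev_pullback, h.map_sub hσ hτ hr]
  rfl

theorem eventually_mem_flow_sub (h : IsLocalFlow (extModel E) Ψ D) {σ : ℝ} {p : ℝ × M}
    (hσ : (σ, p) ∈ D) : ∀ᶠ τ in 𝓝 σ, (τ, p) ∈ D ∧ (τ - σ, Ψ σ p) ∈ D :=
  (h.eventually_mem_orbit hσ).and (h.eventually_mem_sub' σ p)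

theorem hasDerivAt_time_zero (h : IsLocalFlow (extModel E) Ψ D)
    (hX : IsGenerator (extModel E) Ψ X) (p : ℝ × M) :
    HasDerivAt (fun r => (Ψ r p).1) (vec X p).1 0 := by
  have h2 := (hasMFDerivAt_fst (I := 𝓘(ℝ, ℝ)) (I' := 𝓘(ℝ, E)) (x := Ψ 0 p)).comp 0 (hX p)
  have h3 : HasFDerivAt (fun r => (Ψ r p).1) ((ContinuousLinearMap.fst ℝ ℝ E).comp
        ((1 : ℝ →L[ℝ] ℝ).smulRight (vec X (Ψ 0 p)))) 0 :=
    hasMFDerivAt_iff_hasFDerivAt.1 h2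
  refine h3.hasDerivAt.congr_deriv ?_
  rw [h.map_zero]
  simp

theorem vec_fst_eq_zero_iff (p : ℝ × M) : interiorProd X (dt E M) p = 0 ↔ (vec X p).1 = 0 := by
  have h1 : ev (interiorProd X (dt E M)) p ![] = (vec X p).1 := by
    rw [interiorProd_apply]
    exact dt_apply p _
  refine ⟨fun h => ?_, fun h => ?_⟩
  · rw [← h1, ev, h]
    rfl
  · refine ContinuousAlternatingMap.ext fun v => ?_
    have hv : v = ![] := Subsingleton.elim _ _
    rw [hv]
    exact h1.trans h

theorem flow_fst (h : IsLocalFlow (extModel E) Ψ D) (hX : IsGenerator (extModel E) Ψ X)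
    (hdt : ∀ p, (vec X p).1 = 0) {s : ℝ} {p : ℝ × M} (hs : (s, p) ∈ D) :
    (Ψ s p).1 = p.1 := by
  have := eq_of_hasDerivAt_zero (B := fun σ => (Ψ σ p).1) (a := 0) (b := s) fun σ hσ => ?_
  · simpa [h.map_zero] using this
  have hσp := h.mem_of_mem_uIcc hs hσ
  have h1 := hasDerivAt_time_zero h hX (Ψ σ p)
  -- Every `0` becomes `σ - σ`, including the derivative's value, so that the derivative can be
  -- shifted to time `σ`; `congr_deriv` restores the value.
  rw [hdt, ← sub_self σ] at h1
  refine ((h1.comp_sub_const σ σ).congr_of_eventuallyEq ?_).congr_deriv (sub_self σ)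
  filter_upwards [eventually_mem_flow_sub h hσp] with τ hτ
  rw [h.map_sub hσp hτ.1 hτ.2]

theorem tmap_flow_fst (h : IsLocalFlow (extModel E) Ψ D) (hX : IsGenerator (extModel E) Ψ X)
    (hdt : ∀ p, (vec X p).1 = 0) {s : ℝ} {p : ℝ × M} (hs : (s, p) ∈ D) (v : ℝ × E) :
    (tmap (Ψ s) p v).1 = v.1 := by
  have h1 : Prod.fst ∘ Ψ s =ᶠ[𝓝 p] Prod.fst := by
    filter_upwards [h.eventually_mem_time hs] with q hq
    exact flow_fst h hX hdt hq
  have h2 := h1.mfderiv_eq (I := extModel E) (I' := 𝓘(ℝ, ℝ))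
  rw [mfderiv_comp p mdifferentiableAt_fst ((h.contMDiffAt_time hs).mdifferentiableAt (by simp)),
    mfderiv_fst, mfderiv_fst] at h2
  exact DFunLike.congr_fun h2 v

theorem ev_wedge_dTwist_apply (θ : DForm 𝓘(ℝ, E) M 1) (K : ℝ × M → ℝ) (p : ℝ × M) (v w : ℝ × E) :
    ev (wedge (dTwist (hat θ) K) (dt E M)) p ![v, w] =
      (diff K p v - K p * ev (hat θ) p ![v]) * w.1 -
        (diff K p w - K p * ev (hat θ) p ![w]) * v.1 := by
  refine (wedgeLin_one (ev (dTwist (hat θ) K) p) (ev (dt E M) p) v w).trans ?_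
  rw [dt_apply, dt_apply]
  rfl

variable [IsManifold 𝓘(ℝ, E) ∞ M]

theorem ev_ext_one {α β : (ℝ × E) [⋀^Fin 1]→L[ℝ] ℝ} {x₀ : M} {z : ℝ × E}
    (hz : z.2 ∈ (extChartAt 𝓘(ℝ, E) x₀).target)
    (h : ∀ v, α ![chartFrame x₀ z v] = β ![chartFrame x₀ z v]) : α = β :=
  ext_one fun a => by
    obtain ⟨v, rfl⟩ := chartFrame_surjective hz a
    exact h v

theorem ev_ext_two {α β : (ℝ × E) [⋀^Fin 2]→L[ℝ] ℝ} {x₀ : M} {z : ℝ × E}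
    (hz : z.2 ∈ (extChartAt 𝓘(ℝ, E) x₀).target)
    (h : ∀ v w, α ![chartFrame x₀ z v, chartFrame x₀ z w] =
      β ![chartFrame x₀ z v, chartFrame x₀ z w]) : α = β :=
  ext_two fun a b => by
    obtain ⟨v, rfl⟩ := chartFrame_surjective hz a
    obtain ⟨w, rfl⟩ := chartFrame_surjective hz b
    exact h v w

variable {Ω : DForm 𝓘(ℝ, E) M 2} {θ : DForm 𝓘(ℝ, E) M 1}

/-- The derivative in `σ` is zero since `L_X θ̂ = 0`. The chart is chosen afresh around each
`Ψ_σ(p)`, so the orbit need not stay in a single chart. -/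
theorem pullback_flow_lee (h : IsLocalFlow (extModel E) Ψ D) (hX : IsGenerator (extModel E) Ψ X)
    (hLCS : IsLCS Ω θ) (hθ : interiorProd X (hat θ) = 0) {s : ℝ} {p : ℝ × M}
    (hs : (s, p) ∈ D) :
    ev (pullback (I := extModel E) (Ψ s) (hat θ)) p = ev (hat θ) p := by
  refine ext_one fun a => ?_
  have := eq_of_hasDerivAt_zero (a := 0) (b := s)
    (B := fun σ => ev (pullback (I := extModel E) (Ψ σ) (hat θ)) p ![a]) fun σ hσ => ?_
  · simpa [ev_pullback_flow_zero h] using this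
  have hσp := h.mem_of_mem_uIcc hs hσ
  obtain ⟨x₀, z, hz, hq⟩ := exists_chartInv_eq (E := E) (Ψ σ p)
  obtain ⟨v, hv⟩ := chartFrame_surjective hz (tmap (Ψ σ) p a)
  have h1 := hasDerivAt_pullback_lee h hX hLCS hθ hz v
  rw [← sub_self σ] at h1
  refine ((h1.comp_sub_const σ σ).congr_of_eventuallyEq ?_).congr_deriv (by simp)
  filter_upwards [eventually_mem_flow_sub h hσp] with τ hτ
  rw [ev_pullback_flow_sub h _ hσp hτ.1 hτ.2, compCLM_one, hq, hv]

theorem isTimeLeeDiffeo_flow (h : IsLocalFlow (extModel E) Ψ D)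
    (hX : IsGenerator (extModel E) Ψ X) (hLCS : IsLCS Ω θ) (hθ : interiorProd X (hat θ) = 0)
    (hdt : ∀ p, (vec X p).1 = 0) (s : ℝ) :
    IsTimeLeeDiffeo θ (Ψ s) (timeDomain D s) (Ψ s '' timeDomain D s) where
  isOpen_source := h.isOpen_timeDomain s
  isOpen_target := h.isOpen_image s
  image_eq := rfl
  smooth := fun _ hp => (h.contMDiffAt_time hp).contMDiffWithinAt
  smooth_inverse := h.exists_smooth_inverse s
  time := fun _ hp => flow_fst h hX hdt hp
  lee := fun _ hp => pullback_flow_lee h hX hLCS hθ hp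

/-- The derivative of `Ψ_r^* Ω̂` at `r = 0` when the generator is Hamiltonian. -/
theorem hasDerivAt_pullback_hamiltonian_zero (h : IsLocalFlow (extModel E) Ψ D)
    (hX : IsGenerator (extModel E) Ψ X) (hLCS : IsLCS Ω θ) (hθ : interiorProd X (hat θ) = 0)
    {S : Set (ℝ × M)} (hS : IsOpen S) {f : ℝ × M → ℝ} (hf : IsHamiltonianForOn Ω θ X f S)
    {x₀ : M} {z : ℝ × E} (hz : z.2 ∈ (extChartAt 𝓘(ℝ, E) x₀).target)
    (hzS : chartInv x₀ z ∈ S) (v w : ℝ × E) :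
    HasDerivAt (fun r => ev (pullback (I := extModel E) (Ψ r) (hat Ω)) (chartInv x₀ z)
        ![chartFrame x₀ z v, chartFrame x₀ z w])
      ((diff (partialT f) (chartInv x₀ z) (chartFrame x₀ z w) -
          partialT f (chartInv x₀ z) * inChart θ x₀ z.2 ![w.2]) * v.1 -
        (diff (partialT f) (chartInv x₀ z) (chartFrame x₀ z v) -
          partialT f (chartInv x₀ z) * inChart θ x₀ z.2 ![v.2]) * w.1) 0 := by
  set F : ℝ × E → ℝ := f ∘ chartInv x₀ with hF
  set T : ℝ × E → ℝ := partialT f ∘ chartInv x₀ with hT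
  have hfS : ∀ y : ℝ × E, y.2 ∈ (extChartAt 𝓘(ℝ, E) x₀).target → chartInv x₀ y ∈ S →
      ContMDiffAt (extModel E) 𝓘(ℝ, ℝ) ∞ f (chartInv x₀ y) := fun y _ hyS =>
    hf.smooth.contMDiffAt (hS.mem_nhds hyS)
  have hFc : ContDiffAt ℝ ∞ F z := contDiffAt_comp_chartInv hz (hfS z hz hzS)
  have hTm := contMDiffAt_partialT hS hf.smooth hzS
  have hTc : ContDiffAt ℝ ∞ T z := contDiffAt_comp_chartInv hz hTm
  -- The Hamiltonian equation in coordinates: `b` is the chart expression of `d^θ̂ f - f_t dt`.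
  let b : ℝ × E → ℝ × E → ℝ := fun y u =>
    fderiv ℝ F y u - F y * inChart θ x₀ y.2 ![u.2] - T y * u.1
  have hb : ∀ᶠ y in 𝓝 z, ∀ u, b y u =
      ev (interiorProd X (hat Ω)) (chartInv x₀ y) ![chartFrame x₀ y u] := by
    filter_upwards [eventually_mem_target hz,
      (contMDiffAt_chartInv hz).continuousAt.eventually (hS.mem_nhds hzS)] with y hy hyS u
    have h1 : ev (interiorProd X (hat Ω)) (chartInv x₀ y) =
        ev (dFun f) (chartInv x₀ y) - f (chartInv x₀ y) • ev (hat θ) (chartInv x₀ y) -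
          partialT f (chartInv x₀ y) • ev (dt E M) (chartInv x₀ y) :=
      hf.interior_form _ hyS
    rw [h1]
    simp only [ContinuousAlternatingMap.sub_apply, ContinuousAlternatingMap.smul_apply,
      dFun_apply, dt_apply, smul_eq_mul]
    rw [hat_one_chartFrame θ hy, dt_chartFrame hy,
      mfderiv_chartFrame hy ((hfS y hy hyS).mdifferentiableAt (by simp))]
    rfl
  have hθd : DifferentiableAt ℝ (inChart θ x₀) z.2 := ((hLCS.smooth_lee x₀).contDiffAt
    ((isOpen_extChartAt_target x₀).mem_nhds hz)).differentiableAt (by simp)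
  have hθc : ∀ u : E, HasFDerivAt (fun y : ℝ × E => inChart θ x₀ y.2 ![u])
      ((fderiv ℝ (fun y => inChart θ x₀ y ![u]) z.2).comp (ContinuousLinearMap.snd ℝ ℝ E)) z :=
    fun u => HasFDerivAt.comp z (g := fun y => inChart θ x₀ y ![u])
      (hθd.continuousAlternatingMap_apply_const ![u]).hasFDerivAt hasFDerivAt_snd
  have hF1 : HasFDerivAt F (fderiv ℝ F z) z := (hFc.differentiableAt (by simp)).hasFDerivAt
  have hF2 : HasFDerivAt (fderiv ℝ F) (fderiv ℝ (fderiv ℝ F) z) z :=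
    ((hFc.fderiv_right (m := ∞) le_rfl).differentiableAt (by simp)).hasFDerivAt
  have hT1 : HasFDerivAt T (fderiv ℝ T z) z := (hTc.differentiableAt (by simp)).hasFDerivAt
  have hbd : ∀ u a, fderiv ℝ (fun y => b y u) z a = fderiv ℝ (fderiv ℝ F) z a u -
      (F z * fderiv ℝ (fun y => inChart θ x₀ y ![u.2]) z.2 a.2 +
        inChart θ x₀ z.2 ![u.2] * fderiv ℝ F z a) - fderiv ℝ T z a * u.1 := by
    intro u a
    have h1 := (((hF2.clm_apply (hasFDerivAt_const u z)).sub (hF1.mul (hθc u.2))).sub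
      (hT1.mul_const u.1)).fderiv
    have h2 : fderiv ℝ (fun y => b y u) z = _ := h1
    rw [h2]
    simp [mul_comm]
  -- Symmetry of the second derivative and closedness of `θ` amount to `d^θ̂ d^θ̂ f = 0`; only the
  -- contribution of `-f_t dt` survives.
  have hsym : fderiv ℝ (fderiv ℝ F) z v w = fderiv ℝ (fderiv ℝ F) z w v :=
    (hFc.isSymmSndFDerivAt (by simpa using two_le_infty)).eq v w
  have hcl := extDeriv_two_apply hθd v.2 w.2
  rw [extDeriv_inChart_lee hLCS hz] at hcl
  change (0 : ℝ) = _ at hcl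
  refine (hasDerivAt_pullback_form h hX hLCS hθ hz v w hb).congr_deriv ?_
  rw [hbd, hbd, mfderiv_chartFrame hz (hTm.mdifferentiableAt (by simp)),
    mfderiv_chartFrame hz (hTm.mdifferentiableAt (by simp))]
  change _ = (fderiv ℝ T z w - T z * _) * _ - (fderiv ℝ T z v - T z * _) * _
  simp only [b]
  linear_combination hsym + F z * hcl

/-- The derivative of `Ψ_σ^* Ω̂` when the generator is Hamiltonian along the orbit. -/
theorem hasDerivAt_pullback_hamiltonian (h : IsLocalFlow (extModel E) Ψ D)
    (hX : IsGenerator (extModel E) Ψ X) (hLCS : IsLCS Ω θ) (hθ : interiorProd X (hat θ) = 0)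
    (hdt : ∀ p, (vec X p).1 = 0)
    {S : Set (ℝ × M)} (hS : IsOpen S) {f : ℝ × M → ℝ} (hf : IsHamiltonianForOn Ω θ X f S)
    {σ : ℝ} {x₀ : M} {z : ℝ × E} (hz : z.2 ∈ (extChartAt 𝓘(ℝ, E) x₀).target)
    (hσ : (σ, chartInv x₀ z) ∈ D) (hσS : Ψ σ (chartInv x₀ z) ∈ S) (v w : ℝ × E) :
    HasDerivAt (fun τ => ev (pullback (I := extModel E) (Ψ τ) (hat Ω)) (chartInv x₀ z)
        ![chartFrame x₀ z v, chartFrame x₀ z w])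
      ((fderiv ℝ (fun x : ℝ × (ℝ × E) => partialT f (Ψ x.1 (chartInv x₀ x.2))) (σ, z) (0, w) -
          partialT f (Ψ σ (chartInv x₀ z)) * inChart θ x₀ z.2 ![w.2]) * v.1 -
        (fderiv ℝ (fun x : ℝ × (ℝ × E) => partialT f (Ψ x.1 (chartInv x₀ x.2))) (σ, z) (0, v) -
          partialT f (Ψ σ (chartInv x₀ z)) * inChart θ x₀ z.2 ![v.2]) * w.1) σ := by
  set p := chartInv x₀ z with hp
  -- The derivative is computed in a chart at `Ψ_σ(p)` and pulled back. Invariance of `θ̂` and `dt`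
  -- expresses it in the chart at `p`, which does not depend on `σ`.
  obtain ⟨x₁, y, hy, hq⟩ := exists_chartInv_eq (E := E) (Ψ σ p)
  have hTm := contMDiffAt_partialT hS hf.smooth hσS
  have hlee : ∀ u, inChart θ x₀ z.2 ![u.2] = ev (hat θ) (Ψ σ p) ![tmap (Ψ σ) p
      (chartFrame x₀ z u)] := fun u => by
    rw [← hat_one_chartFrame θ hz, ← hp, ← pullback_flow_lee h hX hLCS hθ hσ, ev_pullback,
      compCLM_one]
  have hder : ∀ u, fderiv ℝ (fun x : ℝ × (ℝ × E) => partialT f (Ψ x.1 (chartInv x₀ x.2))) (σ, z)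
      (0, u) = diff (partialT f) (Ψ σ p) (tmap (Ψ σ) p (chartFrame x₀ z u)) := fun u => by
    rw [fderiv_apply_prodMk_zero
      ((contDiffAt_comp_flow h hz hσ hTm).differentiableAt (by simp))]
    have hc : MDifferentiableAt (extModel E) 𝓘(ℝ, ℝ) (partialT f ∘ Ψ σ) p :=
      (hTm.comp p (h.contMDiffAt_time hσ)).mdifferentiableAt (by simp)
    refine (mfderiv_chartFrame hz hc u).symm.trans ?_
    exact DFunLike.congr_fun (mfderiv_comp p (hTm.mdifferentiableAt (by simp))
      ((h.contMDiffAt_time hσ).mdifferentiableAt (by simp))) (chartFrame x₀ z u)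
  have hfst : ∀ u, u.1 = (tmap (Ψ σ) p (chartFrame x₀ z u)).1 := fun u => by
    rw [tmap_flow_fst h hX hdt hσ, dt_chartFrame hz]
  obtain ⟨v', hv⟩ := chartFrame_surjective hy (tmap (Ψ σ) p (chartFrame x₀ z v))
  obtain ⟨w', hw⟩ := chartFrame_surjective hy (tmap (Ψ σ) p (chartFrame x₀ z w))
  have h1 := hasDerivAt_pullback_hamiltonian_zero h hX hLCS hθ hS hf hy (by rwa [hq]) v' w'
  rw [← sub_self σ] at h1
  refine ((h1.comp_sub_const σ σ).congr_of_eventuallyEq ?_).congr_deriv ?_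
  · filter_upwards [eventually_mem_flow_sub h hσ] with τ hτ
    rw [ev_pullback_flow_sub h _ hσ hτ.1 hτ.2, compCLM_two, hq, hv, hw]
  · rw [hlee, hlee, hder, hder, hfst v, hfst w, ← hv, ← hw, ← hq, hat_one_chartFrame θ hy,
      hat_one_chartFrame θ hy, dt_chartFrame hy, dt_chartFrame hy]

/-! ### From Hamiltonian generators to canonical flows -/

variable [FiniteDimensional ℝ E]

/-- Along orbits on which the generator has Hamiltonian function `f`, the form `Ψ_σ^* Ω̂` changes
by `d^θ̂ K ∧ dt`, where `K = -∫ ∂f/∂t ∘ Ψ_σ dσ`. -/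
theorem pullback_flow_form (h : IsLocalFlow (extModel E) Ψ D)
    (hX : IsGenerator (extModel E) Ψ X) (hLCS : IsLCS Ω θ) (hθ : interiorProd X (hat θ) = 0)
    (hdt : ∀ p, (vec X p).1 = 0)
    {S : Set (ℝ × M)} (hS : IsOpen S) {f : ℝ × M → ℝ} (hf : IsHamiltonianForOn Ω θ X f S)
    {a b : ℝ} {p : ℝ × M} (hp : ∀ σ ∈ uIcc a b, (σ, p) ∈ D ∧ Ψ σ p ∈ S) :
    ContMDiffAt (extModel E) 𝓘(ℝ, ℝ) ∞ (fun q => -∫ σ in a..b, partialT f (Ψ σ q)) p ∧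
      ev (pullback (I := extModel E) (Ψ b) (hat Ω)) p =
        ev (pullback (I := extModel E) (Ψ a) (hat Ω)) p +
          ev (wedge (dTwist (hat θ) (fun q => -∫ σ in a..b, partialT f (Ψ σ q))) (dt E M)) p := by
  obtain ⟨x₀, z, hz, rfl⟩ := exists_chartInv_eq (E := E) p
  set K : ℝ × M → ℝ := fun q => -∫ σ in a..b, partialT f (Ψ σ q) with hK
  let F : ℝ × (ℝ × E) → ℝ := fun x => partialT f (Ψ x.1 (chartInv x₀ x.2))
  -- The open set on which the integrand is smooth; the integral is smooth at `z` because the whole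
  -- segment `[a, b] × {z}` lies in `O`.
  let O : Set (ℝ × (ℝ × E)) := {x | x.2.2 ∈ (extChartAt 𝓘(ℝ, E) x₀).target ∧
    (x.1, chartInv x₀ x.2) ∈ D ∧ Ψ x.1 (chartInv x₀ x.2) ∈ S}
  have hO : IsOpen O := by
    rw [isOpen_iff_mem_nhds]
    rintro ⟨r, y⟩ ⟨h1, h2, h3⟩
    have c1 : ContinuousAt (fun x : ℝ × (ℝ × E) => (x.1, chartInv x₀ x.2)) (r, y) :=
      continuousAt_fst.prodMk (ContinuousAt.comp (x := (r, y)) (g := chartInv x₀)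
        (contMDiffAt_chartInv h1).continuousAt continuousAt_snd)
    have c2 : ContinuousAt (fun x : ℝ × (ℝ × E) => Ψ x.1 (chartInv x₀ x.2)) (r, y) :=
      ContinuousAt.comp (x := (r, y)) (g := fun z : ℝ × (ℝ × M) => Ψ z.1 z.2)
        (h.continuousAt h2) c1
    filter_upwards [continuousAt_snd.eventually (eventually_mem_target h1),
      c1.eventually (h.isOpen.mem_nhds h2), c2.eventually (hS.mem_nhds h3)] with x e1 e2 e3
    exact ⟨e1, e2, e3⟩
  have hF : ContDiffOn ℝ ∞ F O := fun x hx => (contDiffAt_comp_flow h hx.1 hx.2.1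
    (contMDiffAt_partialT hS hf.smooth hx.2.2)).contDiffWithinAt
  have hF1 : ContDiffOn ℝ 1 F O := hF.of_le (by exact_mod_cast le_top)
  have hzO : z ∈ segmentTube a b O := fun σ hσ => ⟨hz, hp σ hσ⟩
  have hKc : ContDiffAt ℝ ∞ (K ∘ chartInv x₀) z :=
    (((contDiffOn_intervalIntegral hO hF).contDiffAt
      ((isOpen_segmentTube hO).mem_nhds hzO))).neg
  have hKm := contMDiffAt_of_comp_chartInv hz hKc
  refine ⟨hKm, ev_ext_two hz fun v w => ?_⟩
  have hKd : ∀ u, diff K (chartInv x₀ z) (chartFrame x₀ z u) =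
      -∫ σ in a..b, fderiv ℝ F (σ, z) (0, u) := fun u => by
    rw [mfderiv_chartFrame hz (hKm.mdifferentiableAt (by simp)),
      ← fderiv_intervalIntegral_apply hO hF1 hzO]
    have h1 : fderiv ℝ (K ∘ chartInv x₀) z =
        -fderiv ℝ (fun z => ∫ σ in a..b, F (σ, z)) z := fderiv_fun_neg
    rw [h1]
    rfl
  have hcF : ContinuousOn (fun σ => F (σ, z)) (uIcc a b) :=
    continuousOn_slice hF.continuousOn hzO
  have hcd : ∀ u : ℝ × E, ContinuousOn (fun σ => fderiv ℝ F (σ, z) (0, u)) (uIcc a b) :=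
    fun u => continuousOn_slice (F := fun x => fderiv ℝ F x (0, u))
      ((hF1.continuousOn_fderiv_of_isOpen hO le_rfl).clm_apply continuousOn_const) hzO
  have iF := hcF.intervalIntegrable (μ := MeasureTheory.volume)
  have id' := fun u => (hcd u).intervalIntegrable (μ := MeasureTheory.volume)
  have key := intervalIntegral.integral_eq_sub_of_hasDerivAt (fun σ hσ =>
    hasDerivAt_pullback_hamiltonian h hX hLCS hθ hdt hS hf hz (hp σ hσ).1 (hp σ hσ).2 v w)
    ((((id' w).sub (iF.mul_const _)).mul_const _).sub
      (((id' v).sub (iF.mul_const _)).mul_const _))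
  rw [intervalIntegral.integral_sub (((id' w).sub (iF.mul_const _)).mul_const _)
    (((id' v).sub (iF.mul_const _)).mul_const _), intervalIntegral.integral_mul_const,
    intervalIntegral.integral_mul_const, intervalIntegral.integral_sub (id' w) (iF.mul_const _),
    intervalIntegral.integral_sub (id' v) (iF.mul_const _), intervalIntegral.integral_mul_const,
    intervalIntegral.integral_mul_const] at key
  rw [ContinuousAlternatingMap.add_apply, ev_wedge_dTwist_apply, hKd, hKd, dt_chartFrame hz,
    dt_chartFrame hz, hat_one_chartFrame θ hz, hat_one_chartFrame θ hz]
  have hKz : K (chartInv x₀ z) = -∫ σ in a..b, F (σ, z) := rfl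
  rw [hKz]
  linarith

/-- With a single `f` on all of `ℝ × M`, the formula `K = -∫₀ˢ f_t ∘ Ψ_σ dσ` makes sense on all of
`D_s`: the times from `0` to `s` remain in the flow domain. -/
theorem isCanonical_of_isHamiltonian (h : IsLocalFlow (extModel E) Ψ D)
    (hX : IsGenerator (extModel E) Ψ X) (hLCS : IsLCS Ω θ) (hθ : interiorProd X (hat θ) = 0)
    (hH : IsHamiltonian Ω θ X) (s : ℝ) :
    IsCanonical Ω θ (Ψ s) (timeDomain D s) (Ψ s '' timeDomain D s) := by
  obtain ⟨f, hf⟩ := hH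
  have hdt : ∀ p, (vec X p).1 = 0 := fun p =>
    (vec_fst_eq_zero_iff p).1 (hf.interior_dt p (mem_univ p))
  have key := fun (p : ℝ × M) (hp : p ∈ timeDomain D s) =>
    pullback_flow_form h hX hLCS hθ hdt isOpen_univ hf (a := 0) (b := s) (p := p)
      fun σ hσ => ⟨h.mem_of_mem_uIcc hp hσ, mem_univ _⟩
  refine ⟨isTimeLeeDiffeo_flow h hX hLCS hθ hdt s, _,
    fun p hp => (key p hp).1.contMDiffWithinAt, fun p hp => ?_⟩
  have := (key p hp).2
  rw [ev_pullback_flow_zero h] at this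
  exact this

/-- Since `d^θ̂` is linear, the increment of `K` over a short stretch of orbit is added to the `K`
already found. The order of `a` and `b` is free, so the step also runs backwards in time. -/
theorem isGeneratingOn_of_uIcc (h : IsLocalFlow (extModel E) Ψ D)
    (hX : IsGenerator (extModel E) Ψ X) (hLCS : IsLCS Ω θ) (hθ : interiorProd X (hat θ) = 0)
    (hdt : ∀ p, (vec X p).1 = 0)
    {S : Set (ℝ × M)} (hS : IsOpen S) {f : ℝ × M → ℝ} (hf : IsHamiltonianForOn Ω θ X f S)
    {a b : ℝ} {p : ℝ × M} (hp : ∀ σ ∈ uIcc a b, (σ, p) ∈ D ∧ Ψ σ p ∈ S)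
    (ha : ∃ W, IsOpen W ∧ p ∈ W ∧ ∃ K, IsGeneratingOn Ω θ (Ψ a) K W) :
    ∃ W, IsOpen W ∧ p ∈ W ∧ ∃ K, IsGeneratingOn Ω θ (Ψ b) K W := by
  obtain ⟨W, hW, hpW, K, hK⟩ := ha
  have hO : IsOpen (D ∩ (fun z : ℝ × (ℝ × M) => Ψ z.1 z.2) ⁻¹' S) :=
    h.smooth.continuousOn.isOpen_inter_preimage h.isOpen hS
  refine ⟨W ∩ segmentTube a b _, hW.inter (isOpen_segmentTube hO), ⟨hpW, hp⟩,
    fun q => K q + -∫ σ in a..b, partialT f (Ψ σ q), ?_, ?_⟩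
  · rintro q ⟨hq, hq'⟩
    exact ((hK.smooth.contMDiffAt (hW.mem_nhds hq)).add
      (pullback_flow_form h hX hLCS hθ hdt hS hf fun σ hσ =>
        hq' σ hσ).1).contMDiffWithinAt
  · rintro q ⟨hq, hq'⟩
    obtain ⟨h1, h2⟩ := pullback_flow_form h hX hLCS hθ hdt hS hf fun σ hσ => hq' σ hσ
    have h3 : ev (pullback (I := extModel E) (Ψ a) (hat Ω)) q =
        ev (hat Ω) q + ev (wedge (dTwist (hat θ) K) (dt E M)) q := hK.pullback_form q hq
    have h4 := (hK.smooth.contMDiffAt (hW.mem_nhds hq)).mdifferentiableAt (by simp)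
    have h5 : diff (E := E) (fun q => K q + -∫ σ in a..b, partialT f (Ψ σ q)) q =
        diff K q + diff (fun q => -∫ σ in a..b, partialT f (Ψ σ q)) q :=
      mfderiv_add h4 (h1.mdifferentiableAt (by simp))
    suffices ev (pullback (I := extModel E) (Ψ b) (hat Ω)) q = ev (hat Ω) q +
        ev (wedge (dTwist (hat θ) fun q => K q + -∫ σ in a..b, partialT f (Ψ σ q))
          (dt E M)) q from this
    rw [h2, h3]
    refine ext_two fun v w => ?_
    simp only [ContinuousAlternatingMap.add_apply, ev_wedge_dTwist_apply, h5,
      add_apply]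
    ring

/-- An orbit may cross many sets `ℝ × U`, each with its own `f`. Existence of a generating function
near `p` is locally constant in `σ` and holds at `σ = 0` with `K = 0`. -/
theorem isLocallyCanonical_of_isLocallyHamiltonian (h : IsLocalFlow (extModel E) Ψ D)
    (hX : IsGenerator (extModel E) Ψ X) (hLCS : IsLCS Ω θ) (hθ : interiorProd X (hat θ) = 0)
    (hH : IsLocallyHamiltonian Ω θ X) (s : ℝ) :
    IsLocallyCanonical Ω θ (Ψ s) (timeDomain D s) (Ψ s '' timeDomain D s) := by
  have hdt : ∀ p, (vec X p).1 = 0 := fun p => by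
    obtain ⟨U, -, hpU, f, hf⟩ := hH p.2
    exact (vec_fst_eq_zero_iff p).1 (hf.interior_dt p ⟨mem_univ _, hpU⟩)
  refine ⟨isTimeLeeDiffeo_flow h hX hLCS hθ hdt s, fun p hp => ?_⟩
  suffices ∃ W, IsOpen W ∧ p ∈ W ∧ ∃ K, IsGeneratingOn Ω θ (Ψ s) K W by
    obtain ⟨W, hW, hpW, K, hK⟩ := this
    exact ⟨W ∩ timeDomain D s, hW.inter (h.isOpen_timeDomain s), ⟨hpW, hp⟩, inter_subset_right,
      K, hK.smooth.mono inter_subset_left, fun q hq => hK.pullback_form q hq.1⟩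
  refine uIcc_induction (a := 0) (b := s)
    (Q := fun σ => ∃ W, IsOpen W ∧ p ∈ W ∧ ∃ K, IsGeneratingOn Ω θ (Ψ σ) K W)
    (fun σ hσ => ?_) ?_
  · obtain ⟨U, hU, hpU, f, hf⟩ := hH (Ψ σ p).2
    have hS : IsOpen ((univ : Set ℝ) ×ˢ U) := isOpen_univ.prod hU
    have hσp := h.mem_of_mem_uIcc hp hσ
    have hev : ∀ᶠ τ in 𝓝 σ, (τ, p) ∈ D ∧ Ψ τ p ∈ (univ : Set ℝ) ×ˢ U :=
      (h.eventually_mem_orbit hσp).and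
        ((h.continuousAt_orbit hσp).eventually (hS.mem_nhds ⟨mem_univ _, hpU⟩))
    obtain ⟨ε, hε, hball⟩ := Metric.eventually_nhds_iff_ball.1 hev
    filter_upwards [nhdsWithin_le_nhds (Metric.ball_mem_nhds σ hε)] with τ hτ
    have hsub : uIcc σ τ ⊆ Metric.ball σ ε := by
      rw [← segment_eq_uIcc]
      exact (convex_ball σ ε).segment_subset (Metric.mem_ball_self hε) hτ
    exact ⟨isGeneratingOn_of_uIcc h hX hLCS hθ hdt hS hf fun ρ hρ => hball ρ (hsub hρ),
      isGeneratingOn_of_uIcc h hX hLCS hθ hdt hS hf fun ρ hρ =>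
        hball ρ (hsub (by rwa [uIcc_comm]))⟩
  · refine ⟨univ, isOpen_univ, mem_univ _, fun _ => 0, contMDiffOn_const, fun q _ => ?_⟩
    suffices ev (pullback (I := extModel E) (Ψ 0) (hat Ω)) q = ev (hat Ω) q +
        ev (wedge (dTwist (hat θ) fun _ => 0) (dt E M)) q from this
    rw [ev_pullback_flow_zero h]
    refine ext_two fun v w => ?_
    have h0 : diff (E := E) (fun _ : ℝ × M => (0 : ℝ)) q = 0 := mfderiv_const
    rw [ContinuousAlternatingMap.add_apply, ev_wedge_dTwist_apply, h0]
    simp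

end Preservation

/-! ### One-forms as linear functionals -/

section LinearForms

variable {E : Type*} [NormedAddCommGroup E] [NormedSpace ℝ E]

theorem ofSubsingleton_symm_apply (α : E [⋀^Fin 1]→L[ℝ] ℝ) (v : E) :
    (ContinuousAlternatingMap.ofSubsingleton ℝ E ℝ (0 : Fin 1)).symm α v = α ![v] := by
  obtain ⟨L, rfl⟩ := (ContinuousAlternatingMap.ofSubsingleton ℝ E ℝ (0 : Fin 1)).surjective α
  rw [Equiv.symm_apply_apply]
  rfl

theorem fderiv_clm_apply_const {V : Type*} [NormedAddCommGroup V] [NormedSpace ℝ V]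
    {γ : V → E →L[ℝ] ℝ} {z : V} (hγ : DifferentiableAt ℝ γ z) (a : V) (v : E) :
    fderiv ℝ γ z a v = fderiv ℝ (fun z => γ z v) z a := by
  rw [(hγ.hasFDerivAt.clm_apply (hasFDerivAt_const v z)).fderiv]
  simp

end LinearForms

/-! ### The Poincaré lemma for `d^θ` -/

section TwistedPoincare

variable {T : Type*} [NormedAddCommGroup T] [NormedSpace ℝ T] [FiniteDimensional ℝ T]
  {E : Type*} [NormedAddCommGroup E] [NormedSpace ℝ E] [FiniteDimensional ℝ E]

/-- The Poincaré lemma for the Lichnerowicz–de Rham differential of a closed `1`-form `α`, for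
`1`-forms on a ball depending smoothly on a parameter. -/
theorem exists_twisted_primitive_on_ball {c : E} {R : ℝ} {α β : T × E → E →L[ℝ] ℝ}
    (hα : ContDiffOn ℝ ∞ α (univ ×ˢ Metric.ball c R))
    (hβ : ContDiffOn ℝ ∞ β (univ ×ˢ Metric.ball c R))
    (hαs : ∀ z ∈ (univ : Set T) ×ˢ Metric.ball c R, ∀ v w : E,
      fderiv ℝ α z (0, v) w = fderiv ℝ α z (0, w) v)
    (hβs : ∀ z ∈ (univ : Set T) ×ˢ Metric.ball c R, ∀ v w : E,
      fderiv ℝ β z (0, v) w - fderiv ℝ β z (0, w) v = α z v * β z w - α z w * β z v) :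
    ∃ f : T × E → ℝ, ContDiffOn ℝ ∞ f (univ ×ˢ Metric.ball c R) ∧
      ∀ z ∈ (univ : Set T) ×ˢ Metric.ball c R, ∀ v : E,
        fderiv ℝ f z (0, v) = β z v + f z * α z v := by
  have hSo : IsOpen ((univ : Set T) ×ˢ Metric.ball c R) := isOpen_univ.prod Metric.isOpen_ball
  obtain ⟨g, hg, hgd⟩ := exists_primitive_on_ball hα hαs
  have hgz : ∀ z ∈ (univ : Set T) ×ˢ Metric.ball c R, HasFDerivAt g (fderiv ℝ g z) z :=
    fun z hz => ((hg.contDiffAt (hSo.mem_nhds hz)).differentiableAt (by simp)).hasFDerivAt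
  -- With `α = dg` along `E`, the twisted differential is the conjugate `e^g d e^{-g}`. Hence
  -- `e^{-g} β` is closed, and a primitive `k` of it gives `f = e^g k`.
  obtain ⟨k, hk, hkd⟩ := exists_primitive_on_ball
    (β := fun z => Real.exp (-g z) • β z) (c := c) (R := R)
    ((Real.contDiff_exp.comp_contDiffOn hg.neg).smul hβ) (fun z hz v w => by
      have h1 := (hgz z hz).neg.exp
      have h2 := ((hβ.contDiffAt (hSo.mem_nhds hz)).differentiableAt (by simp)).hasFDerivAt
      have h3 := (h1.smul h2).fderiv
      have h4 : fderiv ℝ (fun z => Real.exp (-g z) • β z) z = _ := h3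
      rw [h4]
      simp [hgd z hz]
      linear_combination Real.exp (-g z) * hβs z hz v w)
  refine ⟨fun z => Real.exp (g z) * k z, (Real.contDiff_exp.comp_contDiffOn hg).mul hk,
    fun z hz v => ?_⟩
  have h1 := (hgz z hz).exp.mul
    ((hk.contDiffAt (hSo.mem_nhds hz)).differentiableAt (by simp)).hasFDerivAt
  have h2 : fderiv ℝ (fun z => Real.exp (g z) * k z) z = _ := h1.fderiv
  rw [h2]
  simp only [add_apply, smul_apply, smul_eq_mul, hkd z hz, hgd z hz]
  have h3 : Real.exp (g z) * Real.exp (-g z) = 1 := by rw [← Real.exp_add]; simp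
  linear_combination β z v * h3

end TwistedPoincare

/-! ### From locally canonical flows to locally Hamiltonian generators -/

section LocallyHamiltonian

variable {E : Type*} [NormedAddCommGroup E] [NormedSpace ℝ E]
  {M : Type*} [TopologicalSpace M] [ChartedSpace E M]
  {Ψ : ℝ → ℝ × M → ℝ × M} {D : Set (ℝ × (ℝ × M))}
  {X : (p : ℝ × M) → TangentSpace (extModel E) p}
  {Ω : DForm 𝓘(ℝ, E) M 2} {θ : DForm 𝓘(ℝ, E) M 1}

/-- The chart expression of the Lee form on `ℝ × M`, as a linear form in the space directions. -/
def leeChart (θ : DForm 𝓘(ℝ, E) M 1) (x₀ : M) (z : ℝ × E) : E →L[ℝ] ℝ :=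
  (ContinuousAlternatingMap.ofSubsingleton ℝ E ℝ (0 : Fin 1)).symm (inChart θ x₀ z.2)

/-- The chart expression of the contraction of `Ω̂` with the generator of a flow, as a linear form
in the space directions. -/
def contractionChart (Ω : DForm 𝓘(ℝ, E) M 2) (Ψ : ℝ → ℝ × M → ℝ × M) (x₀ : M) (z : ℝ × E) :
    E →L[ℝ] ℝ :=
  (ContinuousAlternatingMap.ofSubsingleton ℝ E ℝ (0 : Fin 1)).symm
    ((inChart Ω x₀ z.2).curryLeft (fderiv ℝ (flowChart x₀ Ψ) (0, z) (1, 0)))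

theorem leeChart_apply (x₀ : M) (z : ℝ × E) (v : E) :
    leeChart θ x₀ z v = inChart θ x₀ z.2 ![v] := ofSubsingleton_symm_apply _ _

theorem contractionChart_apply (x₀ : M) (z : ℝ × E) (v : E) :
    contractionChart Ω Ψ x₀ z v =
      inChart Ω x₀ z.2 ![fderiv ℝ (flowChart x₀ Ψ) (0, z) (1, 0), v] :=
  ofSubsingleton_symm_apply _ _

variable [FiniteDimensional ℝ E]

theorem contDiffOn_leeChart (hLCS : IsLCS Ω θ) (x₀ : M) :
    ContDiffOn ℝ ∞ (leeChart θ x₀) (univ ×ˢ (extChartAt 𝓘(ℝ, E) x₀).target) := by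
  refine contDiffOn_clm_apply.2 fun v => ?_
  simp only [leeChart_apply]
  exact (ContinuousAlternatingMap.apply ℝ E ℝ ![v]).contDiff.comp_contDiffOn
    ((hLCS.smooth_lee x₀).comp contDiffOn_snd fun z hz => hz.2)

variable [IsManifold 𝓘(ℝ, E) ∞ M]

theorem contDiffOn_contractionChart (h : IsLocalFlow (extModel E) Ψ D) (hLCS : IsLCS Ω θ)
    (x₀ : M) :
    ContDiffOn ℝ ∞ (contractionChart Ω Ψ x₀) (univ ×ˢ (extChartAt 𝓘(ℝ, E) x₀).target) := by
  refine contDiffOn_clm_apply.2 fun v => ?_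
  have h1 : ContDiffOn ℝ ∞ (fun z : ℝ × E => fderiv ℝ (flowChart x₀ Ψ) (0, z) (1, 0))
      (univ ×ˢ (extChartAt 𝓘(ℝ, E) x₀).target) := by
    intro z hz
    have h2 := ((contDiffAt_flowChart_zero h hz.2).fderiv_right (m := ∞) le_rfl).comp z
      (f := fun z : ℝ × E => ((0 : ℝ), z)) (by fun_prop)
    exact (h2.clm_apply contDiffAt_const).contDiffWithinAt
  have h2 : ContDiffOn ℝ ∞ (fun z : ℝ × E => inChart Ω x₀ z.2)
      (univ ×ˢ (extChartAt 𝓘(ℝ, E) x₀).target) :=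
    (hLCS.smooth_form x₀).comp contDiffOn_snd fun z hz => hz.2
  -- Only the generator's slot moves with `z`. Swapping the arguments, at the cost of a sign, makes
  -- the contraction a smooth linear form `Ω(v, ·)` applied to a smooth vector, the time derivative
  -- of the flow.
  have h3 : ContDiffOn ℝ ∞ (fun z : ℝ × E =>
      (ContinuousAlternatingMap.ofSubsingleton ℝ E ℝ (0 : Fin 1)).symm
        ((inChart Ω x₀ z.2).curryLeft v)) (univ ×ˢ (extChartAt 𝓘(ℝ, E) x₀).target) := by
    refine contDiffOn_clm_apply.2 fun a => ?_
    simp only [ofSubsingleton_symm_apply]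
    exact (ContinuousAlternatingMap.apply ℝ E ℝ ![v, a]).contDiff.comp_contDiffOn h2
  refine (h3.clm_apply h1).neg.congr fun z _ => ?_
  rw [contractionChart_apply, ofSubsingleton_symm_apply]
  have h4 : ![fderiv ℝ (flowChart x₀ Ψ) (0, z) (1, 0), v] =
      ![v, fderiv ℝ (flowChart x₀ Ψ) (0, z) (1, 0)] ∘ Equiv.swap (0 : Fin 2) 1 := by
    funext i
    fin_cases i <;> rfl
  rw [h4]
  exact (inChart Ω x₀ z.2).toAlternatingMap.map_swap _ (zero_ne_one' (Fin 2))

theorem fderiv_leeChart_symm (hLCS : IsLCS Ω θ) {x₀ : M} {z : ℝ × E}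
    (hz : z.2 ∈ (extChartAt 𝓘(ℝ, E) x₀).target) (v w : E) :
    fderiv ℝ (leeChart θ x₀) z (0, v) w = fderiv ℝ (leeChart θ x₀) z (0, w) v := by
  have hd : DifferentiableAt ℝ (leeChart θ x₀) z := ((contDiffOn_leeChart hLCS x₀).contDiffAt
    ((isOpen_univ.prod (isOpen_extChartAt_target x₀)).mem_nhds
      ⟨mem_univ _, hz⟩)).differentiableAt (by simp)
  have hθd : DifferentiableAt ℝ (inChart θ x₀) z.2 := ((hLCS.smooth_lee x₀).contDiffAt
    ((isOpen_extChartAt_target x₀).mem_nhds hz)).differentiableAt (by simp)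
  have hc : ∀ u a : E, fderiv ℝ (fun y : ℝ × E => inChart θ x₀ y.2 ![u]) z (0, a) =
      fderiv ℝ (fun y => inChart θ x₀ y ![u]) z.2 a := fun u a => by
    have h1 := (HasFDerivAt.comp z (g := fun y => inChart θ x₀ y ![u])
      (hθd.continuousAlternatingMap_apply_const ![u]).hasFDerivAt hasFDerivAt_snd).fderiv
    have h2 : fderiv ℝ (fun y : ℝ × E => inChart θ x₀ y.2 ![u]) z = _ := h1
    rw [h2]
    rfl
  have hcl := extDeriv_two_apply hθd v w
  rw [extDeriv_inChart_lee hLCS hz] at hcl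
  change (0 : ℝ) = _ at hcl
  rw [fderiv_clm_apply_const hd, fderiv_clm_apply_const hd]
  simp only [leeChart_apply, hc]
  linarith

/-- On pairs of slice-tangent vectors `Ψ_s^* Ω̂` is constant in `s`, so its derivative at `0`, which
is `d^θ̂ (X ⌟ Ω̂)`, vanishes there. This is the hypothesis of the twisted Poincaré lemma. -/
theorem fderiv_contractionChart (h : IsLocalFlow (extModel E) Ψ D)
    (hX : IsGenerator (extModel E) Ψ X) (hLCS : IsLCS Ω θ) (hθ : interiorProd X (hat θ) = 0)
    (hΩ : ∀ (s : ℝ) (p : ℝ × M), (s, p) ∈ D → ∀ v w : ℝ × E, v.1 = 0 → w.1 = 0 →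
      ev (pullback (I := extModel E) (Ψ s) (hat Ω)) p ![v, w] = ev (hat Ω) p ![v, w])
    {x₀ : M} {z : ℝ × E} (hz : z.2 ∈ (extChartAt 𝓘(ℝ, E) x₀).target) (v w : E) :
    fderiv ℝ (contractionChart Ω Ψ x₀) z (0, v) w -
        fderiv ℝ (contractionChart Ω Ψ x₀) z (0, w) v =
      leeChart θ x₀ z v * contractionChart Ω Ψ x₀ z w -
        leeChart θ x₀ z w * contractionChart Ω Ψ x₀ z v := by
  have hd : DifferentiableAt ℝ (contractionChart Ω Ψ x₀) z :=
    ((contDiffOn_contractionChart h hLCS x₀).contDiffAt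
      ((isOpen_univ.prod (isOpen_extChartAt_target x₀)).mem_nhds
        ⟨mem_univ _, hz⟩)).differentiableAt (by simp)
  have h1 := hasDerivAt_pullback_form h hX hLCS hθ hz (0, v) (0, w)
    (b := fun y u => contractionChart Ω Ψ x₀ y u.2) (by
      filter_upwards [eventually_mem_target hz] with y hy u
      rw [contractionChart_apply, interiorProd_hat_two h hX Ω hy])
  have h2 : (fun r => ev (pullback (I := extModel E) (Ψ r) (hat Ω)) (chartInv x₀ z)
      ![chartFrame x₀ z (0, v), chartFrame x₀ z (0, w)]) =ᶠ[𝓝 0] fun _ =>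
        ev (hat Ω) (chartInv x₀ z) ![chartFrame x₀ z (0, v), chartFrame x₀ z (0, w)] := by
    filter_upwards [h.eventually_mem_orbit (h.zero_mem (chartInv x₀ z))] with r hr
    exact hΩ r _ hr _ _ (dt_chartFrame hz (0, v)) (dt_chartFrame hz (0, w))
  have h3 := h1.unique ((hasDerivAt_const (0 : ℝ) _).congr_of_eventuallyEq h2)
  rw [fderiv_clm_apply_const hd, fderiv_clm_apply_const hd, leeChart_apply, leeChart_apply]
  linarith

/-- On a chart ball, the twisted Poincaré lemma with parameter `t` solves the equation in the space
directions. On `∂/∂t` both sides vanish: `Ω̂` is pulled back from `M`, and `f_t` cancels against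
`f_t dt`. -/
theorem isLocallyHamiltonian_of_slices (h : IsLocalFlow (extModel E) Ψ D)
    (hX : IsGenerator (extModel E) Ψ X) (hLCS : IsLCS Ω θ) (hθ : interiorProd X (hat θ) = 0)
    (hdt : ∀ p, (vec X p).1 = 0)
    (hΩ : ∀ (s : ℝ) (p : ℝ × M), (s, p) ∈ D → ∀ v w : ℝ × E, v.1 = 0 → w.1 = 0 →
      ev (pullback (I := extModel E) (Ψ s) (hat Ω)) p ![v, w] = ev (hat Ω) p ![v, w]) :
    IsLocallyHamiltonian Ω θ X := by
  intro x₀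
  obtain ⟨R, hR, hball⟩ := Metric.isOpen_iff.1 (isOpen_extChartAt_target (I := 𝓘(ℝ, E)) x₀)
    (extChartAt 𝓘(ℝ, E) x₀ x₀) (mem_extChartAt_target x₀)
  set B := Metric.ball (extChartAt 𝓘(ℝ, E) x₀ x₀) R
  have hsub : (univ : Set ℝ) ×ˢ B ⊆ univ ×ˢ (extChartAt 𝓘(ℝ, E) x₀).target :=
    prod_mono_right hball
  obtain ⟨f, hf, hfd⟩ := exists_twisted_primitive_on_ball
    ((contDiffOn_leeChart hLCS x₀).mono hsub)
    ((contDiffOn_contractionChart h hLCS x₀).mono hsub)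
    (fun z hz v w => fderiv_leeChart_symm hLCS (hball hz.2) v w)
    (fun z hz v w => fderiv_contractionChart h hX hLCS hθ hΩ (hball hz.2) v w)
  have hBo : IsOpen ((univ : Set ℝ) ×ˢ B) := isOpen_univ.prod Metric.isOpen_ball
  have hcomp : ∀ z : ℝ × E, z.2 ∈ B → (f ∘ chartMap x₀) ∘ chartInv x₀ =ᶠ[𝓝 z] f := by
    intro z hz
    filter_upwards [eventually_mem_target (hball hz)] with y hy
    simp only [Function.comp_apply]
    rw [chartMap_chartInv hy]
  have hsm : ∀ z : ℝ × E, z.2 ∈ B →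
      ContMDiffAt (extModel E) 𝓘(ℝ, ℝ) ∞ (f ∘ chartMap x₀) (chartInv x₀ z) := fun z hz =>
    contMDiffAt_of_comp_chartInv (hball hz)
      ((hf.contDiffAt (hBo.mem_nhds ⟨mem_univ _, hz⟩)).congr_of_eventuallyEq (hcomp z hz))
  have hrep : ∀ p ∈ (univ : Set ℝ) ×ˢ ((extChartAt 𝓘(ℝ, E) x₀).source ∩
      extChartAt 𝓘(ℝ, E) x₀ ⁻¹' B), ∃ z : ℝ × E, z.2 ∈ B ∧ chartInv x₀ z = p :=
    fun p hp => ⟨chartMap x₀ p, hp.2.2, chartInv_chartMap hp.2.1⟩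
  refine ⟨(extChartAt 𝓘(ℝ, E) x₀).source ∩ extChartAt 𝓘(ℝ, E) x₀ ⁻¹' B,
    (continuousOn_extChartAt x₀).isOpen_inter_preimage (isOpen_extChartAt_source x₀)
      Metric.isOpen_ball, ⟨mem_extChartAt_source x₀, Metric.mem_ball_self hR⟩,
    f ∘ chartMap x₀, ?_, fun p _ => (vec_fst_eq_zero_iff p).2 (hdt p), ?_⟩
  · intro p hp
    obtain ⟨z, hz, rfl⟩ := hrep p hp
    exact (hsm z hz).contMDiffWithinAt
  · intro p hp
    obtain ⟨z, hz, rfl⟩ := hrep p hp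
    have hzt := hball hz
    have hfz : DifferentiableAt ℝ f z :=
      (hf.contDiffAt (hBo.mem_nhds ⟨mem_univ _, hz⟩)).differentiableAt (by simp)
    suffices ev (interiorProd X (hat Ω)) (chartInv x₀ z) =
        ev (dFun (f ∘ chartMap x₀)) (chartInv x₀ z) -
          (f ∘ chartMap x₀) (chartInv x₀ z) • ev (hat θ) (chartInv x₀ z) -
          partialT (f ∘ chartMap x₀) (chartInv x₀ z) • ev (dt E M) (chartInv x₀ z) from this
    refine ev_ext_one hzt fun v => ?_
    simp only [ContinuousAlternatingMap.sub_apply, ContinuousAlternatingMap.smul_apply,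
      dFun_apply, dt_apply, smul_eq_mul]
    rw [hat_one_chartFrame θ hzt, dt_chartFrame hzt,
      mfderiv_chartFrame hzt ((hsm z hz).mdifferentiableAt (by simp)),
      partialT_chartInv (hfz.congr_of_eventuallyEq (hcomp z hz)), (hcomp z hz).fderiv_eq,
      interiorProd_hat_two h hX Ω hzt, ← contractionChart_apply, ← leeChart_apply]
    have h1 := hfd z ⟨mem_univ _, hz⟩ v.2
    have h2 : fderiv ℝ f z v = v.1 * fderiv ℝ f z (1, 0) + fderiv ℝ f z (0, v.2) := by
      rw [← smul_eq_mul, ← map_smul, ← map_add]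
      congr 1
      ext <;> simp
    simp only [Function.comp_apply]
    rw [chartMap_chartInv hzt, h2, h1]
    ring

/-- Preservation of `t` gives `dt(X) = 0`, and the factor `dt` removes `K` on slice-tangent vectors.
No control over how `K` varies with `s` is therefore needed. -/
theorem isLocallyHamiltonian_of_isLocallyCanonical (h : IsLocalFlow (extModel E) Ψ D)
    (hX : IsGenerator (extModel E) Ψ X) (hLCS : IsLCS Ω θ) (hθ : interiorProd X (hat θ) = 0)
    (hC : ∀ s : ℝ, IsLocallyCanonical Ω θ (Ψ s) (timeDomain D s) (Ψ s '' timeDomain D s)) :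
    IsLocallyHamiltonian Ω θ X := by
  refine isLocallyHamiltonian_of_slices h hX hLCS hθ (fun p => ?_) fun s p hs v w hv hw => ?_
  · refine (hasDerivAt_time_zero h hX p).unique
      ((hasDerivAt_const (0 : ℝ) p.1).congr_of_eventuallyEq ?_)
    filter_upwards [h.eventually_mem_orbit (h.zero_mem p)] with r hr
    exact (hC r).1.time p hr
  · obtain ⟨W, -, hpW, -, K, hK⟩ := (hC s).2 p hs
    have h1 : ev (pullback (I := extModel E) (Ψ s) (hat Ω)) p =
        ev (hat Ω) p + ev (wedge (dTwist (hat θ) K) (dt E M)) p := hK.pullback_form p hpW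
    rw [h1, ContinuousAlternatingMap.add_apply, ev_wedge_dTwist_apply, hv, hw]
    simp

end LocallyHamiltonian

end LCS

end

open LCS in
theorem mainTheorem1 {E : Type*} [NormedAddCommGroup E] [NormedSpace ℝ E] [FiniteDimensional ℝ E]
    {M : Type*} [TopologicalSpace M] [T2Space M] [ChartedSpace E M] [IsManifold 𝓘(ℝ, E) ∞ M]
    (Ω : DForm 𝓘(ℝ, E) M 2) (θ : DForm 𝓘(ℝ, E) M 1) (hLCS : IsLCS Ω θ)
    (Ψ : ℝ → ℝ × M → ℝ × M) (D : Set (ℝ × (ℝ × M))) (hΨ : IsLocalFlow (extModel E) Ψ D)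
    (X : (p : ℝ × M) → TangentSpace (extModel E) p)
    (hX : ContMDiff (extModel E) (extModel E).tangent ∞
      (fun p : ℝ × M => (⟨p, X p⟩ : TangentBundle (extModel E) (ℝ × M))))
    (hgen : IsGenerator (extModel E) Ψ X)
    (hlee : interiorProd X (hat θ) = 0) :
    ((∀ s : ℝ, IsLocallyCanonical Ω θ (Ψ s) (timeDomain D s) (Ψ s '' timeDomain D s)) ↔
        IsLocallyHamiltonian Ω θ X) ∧
      (IsHamiltonian Ω θ X →
        ∀ s : ℝ, IsCanonical Ω θ (Ψ s) (timeDomain D s) (Ψ s '' timeDomain D s)) := by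
  exact ⟨⟨isLocallyHamiltonian_of_isLocallyCanonical hΨ hgen hLCS hlee,
    isLocallyCanonical_of_isLocallyHamiltonian hΨ hgen hLCS hlee⟩,
    isCanonical_of_isHamiltonian hΨ hgen hLCS hlee⟩
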